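/- Let $(\mathcal M,g)$ be a smooth Riemannian $d$-manifold and let $M\subset\mathcal M$ be a compact embedded $d$-dimensional submanifold, possibly with smooth boundary (or corners). Let $T>0$, let $V$ be a time-dependent vector field that is smooth on $[0,T]\times\mathcal M$, and let $\Phi^t$, $t\in[0,T]$, be its flow map on $M$: a family of diffeomorphisms $\Phi^t\colon M\to\Phi^t(M)\subseteq\mathcal M$, smooth in $(t,x)\in[0,T]\times M$, with $\Phi^0=\mathrm{id}_M$ and $\partial_t\Phi^t(x)=V(t,\Phi^t(x))$. Let $\rho$ be a smooth function on $[0,T]\times\mathcal M$ with $\rho(0,\cdot)>0$ that solves the continuity equation $$\partial_t\rho+\mathrm d\rho(V)=-\rho\,\mathrm{div}(V),$$ where $\mathrm{div}$ is the divergence of the Riemannian volume $\omega_g$. Put $g(t)=(\Phi^t)^*g$ (a Riemannian metric on $M$ with dual metric $g(t)^{-1}$), $\mathrm d\mu(t)=(\rho(t,\cdot)\circ\Phi^t)\,\omega_{g(t)}$ and $\mathrm d\mu_0=\rho(0,\cdot)\,\omega_g$ on $M$. For a Riemannian metric $h$ and a measure $\mu$ on $M$ with a smooth positive density, let $\mathrm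 d$ be the $L^2(\mu)$-closure of the exterior derivative on $C^\infty(M)$, with domain $H^1(M,\mu)$, as an operator from real-valued functions in $L^2(M,\mu)$ to square-integrable one-forms with inner product $\int_M h^{-1}(\alpha,\beta)\,\mathrm d\mu$, let $\mathrm d_\mu^*$ be its Hilbert space adjoint, and let $-\Delta_{h,\mu}=\mathrm d_\mu^*\mathrm d$ be the negative generalized Laplace–Beltrami operator. That is, $u\in\mathrm{dom}(\Delta_{h,\mu})$ and $-\Delta_{h,\mu}u=f$ if and only if $u\in H^1(M,\mu)$, $f\in L^2(M,\mu)$ and $$\int_M v f\,\mathrm d\mu=\int_M h^{-1}(\mathrm dv,\mathrm du)\,\mathrm d\mu\qquad\text{for all }v\in C^\infty(M)$$ (if $\partial M\ne\emptyset$, this is the operator with the zero Neumann boundary condition). Then for each $t\in[0,T]$ one has $\mu(t)=\mu_0$, and $-\Delta_{g(t),\mu(t)}$ is a densely defined self-adjoint operator on the fixed Hilbert space $L^2(M,\mu_0)$. -/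

import Mathlib

open Set Filter Topology MeasureTheory
open scoped Manifold ContDiff

noncomputable section

namespace LagrangianHeat

variable {d : ℕ}
  {H : Type*} [TopologicalSpace H] (I : ModelWithCorners ℝ (EuclideanSpace ℝ (Fin d)) H)
  {M : Type*} [TopologicalSpace M] [ChartedSpace H M]
  {H' : Type*} [TopologicalSpace H'] (J : ModelWithCorners ℝ (EuclideanSpace ℝ (Fin d)) H')
  {N : Type*} [TopologicalSpace N] [ChartedSpace H' N]

/-! ### Tensor fields on a manifold -/

/-- (Not necessarily continuous) fields of bilinear forms on the tangent spaces of `M`. -/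
abbrev BilinField (M : Type*) [TopologicalSpace M] [ChartedSpace H M] : Type _ :=
  ∀ x : M, TangentSpace I x →L[ℝ] TangentSpace I x →L[ℝ] ℝ

/-- (Not necessarily continuous or measurable) one-forms on `M`. -/
abbrev OneForm (M : Type*) [TopologicalSpace M] [ChartedSpace H M] : Type _ :=
  ∀ x : M, TangentSpace I x →L[ℝ] ℝ

/-- The exterior derivative `df` of a real function. -/
def extDer (f : M → ℝ) : OneForm I M :=
  fun x => mfderiv I 𝓘(ℝ, ℝ) f x

/-- The dual metric `h⁻¹(α, β) = α(β♯)` on the cotangent space at `x`, where `β♯` is the tangent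
vector with `h(β♯, ·) = β`. -/
def dualMetric (h : BilinField I M) (x : M) (α β : TangentSpace I x →L[ℝ] ℝ) : ℝ :=
  α ((h x).inverse β)

/-- The pullback `(F^*g)_x(u, v) = g_{F x}(dF u, dF v)` of a field of bilinear forms. -/
def pullbackMetric (F : M → N) (g : BilinField J N) : BilinField I M :=
  fun x => (ContinuousLinearMap.precomp ℝ (mfderiv I J F x)).comp
    ((g (F x)).comp (mfderiv I J F x))

/-! ### The Riemannian volume -/

/-- The `i`-th coordinate vector field `∂_i` of the chart around `x₀`, at the point with
coordinates `y`. -/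
def coordVec (x₀ : M) (y : EuclideanSpace ℝ (Fin d)) (i : Fin d) :
    TangentSpace I ((extChartAt I x₀).symm y) :=
  mfderivWithin 𝓘(ℝ, EuclideanSpace ℝ (Fin d)) I (extChartAt I x₀).symm (range I) y
    (EuclideanSpace.single i (1 : ℝ) : EuclideanSpace ℝ (Fin d))

/-- The volume density `√det (h(∂_i, ∂_j))` in the chart around `x₀`, at the point with
coordinates `y`. -/
def volDensity (h : BilinField I M) (x₀ : M) (y : EuclideanSpace ℝ (Fin d)) : ℝ :=
  Real.sqrt (Matrix.of fun i j : Fin d =>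
    h ((extChartAt I x₀).symm y) (coordVec I x₀ y i) (coordVec I x₀ y j)).det

/-- The part of the Riemannian volume of `h` that lives on the domain of the chart around `x₀`:
`√det (h(∂_i, ∂_j)) dy` on the coordinate domain, transported to `M`. -/
def chartVolume [MeasurableSpace M] (h : BilinField I M) (x₀ : M) : Measure M :=
  (((volume : Measure (EuclideanSpace ℝ (Fin d))).restrict (extChartAt I x₀).target).withDensity
    fun y => ENNReal.ofReal (volDensity I h x₀ y)).map (extChartAt I x₀).symm

/-- The Riemannian volume measure `ω_h`. The measures `chartVolume I h x₀` agree on overlaps of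
chart domains, and `ω_h`, the measure that restricts to each of them on its chart domain, is
their least upper bound. -/
def riemVolume [MeasurableSpace M] (h : BilinField I M) : Measure M :=
  ⨆ x₀ : M, chartVolume I h x₀

/-- The divergence of a vector field with respect to the Riemannian volume of `g`, computed in the
chart around the point: `(1/s) ∑_i ∂_i (s V^i)` with `s = √det (g(∂_i, ∂_j))`. -/
def divergence (g : BilinField J N) (V : ∀ y : N, TangentSpace J y) (y : N) : ℝ :=
  (volDensity J g y (extChartAt J y y))⁻¹ *
    LinearMap.trace ℝ (EuclideanSpace ℝ (Fin d))
      (fderivWithin ℝ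
        (fun z : EuclideanSpace ℝ (Fin d) => volDensity J g y z •
          (VectorField.mpullbackWithin 𝓘(ℝ, EuclideanSpace ℝ (Fin d)) J (extChartAt J y).symm V
            (range J) z : EuclideanSpace ℝ (Fin d)))
        (range J) (extChartAt J y y)).toLinearMap

/-! ### The flow and the conservation of mass -/

/-- `F` is a smooth embedding of the compact manifold `M` (that is, a diffeomorphism onto an
embedded submanifold): smooth, injective, and with injective differentials. -/
structure IsEmbedded (F : M → N) : Prop where
  smooth : ContMDiff I J ∞ F
  injective : Function.Injective F
  immersive : ∀ x, Function.Injective (mfderiv I J F x)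

/-- The time-dependent vector field `V` is smooth on `[0, T] × N`. -/
def IsSmoothTimeDepField [IsManifold J ∞ N] (T : ℝ) (V : ℝ → ∀ y : N, TangentSpace J y) : Prop :=
  ContMDiffOn (𝓘(ℝ, ℝ).prod J) J.tangent ∞
    (fun p : ℝ × N => (⟨p.2, V p.1 p.2⟩ : TangentBundle J N)) (Icc 0 T ×ˢ univ)

/-- `Φ` is the flow map on `[0, T]` of the vector field `V` on `N`, for particles that start in
the submanifold `M` of `N` with inclusion `ι`: a smooth one-parameter family of diffeomorphisms
of `M` onto their images, with `Φ 0 = ι`, that solves `∂_t Φ^t(x) = V(t, Φ^t(x))`. -/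
structure IsFlowMap (T : ℝ) (V : ℝ → ∀ y : N, TangentSpace J y) (ι : M → N) (Φ : ℝ → M → N) :
    Prop where
  smooth : ContMDiffOn (𝓘(ℝ, ℝ).prod I) J ∞ (fun p : ℝ × M => Φ p.1 p.2) (Icc 0 T ×ˢ univ)
  embedded : ∀ t ∈ Icc 0 T, IsEmbedded I J (Φ t)
  initial : Φ 0 = ι
  ode : ∀ t ∈ Icc 0 T, ∀ x, HasMFDerivWithinAt 𝓘(ℝ, ℝ) J (fun s => Φ s x) (Icc 0 T) t
    ((1 : ℝ →L[ℝ] ℝ).smulRight (V t (Φ t x)))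

/-- `ρ` is a smooth solution of the continuity equation
`∂_t ρ + dρ(V) = -ρ div V` on `[0, T] × N`, with a positive initial value. -/
structure IsMassDensity (T : ℝ) (g : BilinField J N) (V : ℝ → ∀ y : N, TangentSpace J y)
    (ρ : ℝ → N → ℝ) : Prop where
  smooth : ContMDiffOn (𝓘(ℝ, ℝ).prod J) 𝓘(ℝ, ℝ) ∞ (fun p : ℝ × N => ρ p.1 p.2) (Icc 0 T ×ˢ univ)
  pos_initial : ∀ y, 0 < ρ 0 y
  continuity : ∀ t ∈ Icc 0 T, ∀ y, HasDerivWithinAt (fun s => ρ s y)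
    (-(extDer J (ρ t) y (V t y)) - ρ t y * divergence J g (V t) y) (Icc 0 T) t

/-- The measure `r(F x) dω_{F^*g}(x)` on `M`, the pullback of the measure `r dω_g` under `F`. -/
def massMeasure [MeasurableSpace M] (g : BilinField J N) (F : M → N) (r : N → ℝ) : Measure M :=
  (riemVolume I (pullbackMetric I J F g)).withDensity fun x => ENNReal.ofReal (r (F x))

/-! ### The generalized Laplace–Beltrami operator `Δ_{h,μ} = -d_μ^* d` -/

/-- The one-form `α` belongs to `L²(M, h, μ)`: it is measurable (its values on smooth vector
fields are measurable functions) and `∫ h⁻¹(α, α) dμ < ∞`. -/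
structure MemL2OneForm [IsManifold I ∞ M] [MeasurableSpace M]
    (h : BilinField I M) (μ : Measure M)
    (α : OneForm I M) : Prop where
  measurable : ∀ X : ∀ x : M, TangentSpace I x,
    ContMDiff I I.tangent ∞ (fun x => (⟨x, X x⟩ : TangentBundle I M)) →
      AEMeasurable (fun x => α x (X x)) μ
  sq_integrable : ∫⁻ x, ENNReal.ofReal (dualMetric I h x (α x) (α x)) ∂μ < ⊤

/-- `u` belongs to `H¹(M, μ)` and `α = du`: the pair `(u, α)` lies in the `L²`-closure of the
graph of the exterior derivative on `C^∞(M)`. -/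
def IsSobolevDifferential [IsManifold I ∞ M] [MeasurableSpace M]
    (h : BilinField I M) (μ : Measure M)
    (u : M → ℝ) (α : OneForm I M) : Prop :=
  MemLp u 2 μ ∧ MemL2OneForm I h μ α ∧
    ∃ w : ℕ → M → ℝ, (∀ n, ContMDiff I 𝓘(ℝ, ℝ) ∞ (w n)) ∧
      Tendsto (fun n => eLpNorm (w n - u) 2 μ) atTop (𝓝 0) ∧
      Tendsto (fun n => ∫⁻ x, ENNReal.ofReal
        (dualMetric I h x (extDer I (w n) x - α x) (extDer I (w n) x - α x)) ∂μ) atTop (𝓝 0)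

/-- The one-form `α` lies in the domain of the `L²`-adjoint `d_μ^*` of the exterior derivative,
and `d_μ^* α = f`. If `M` has a boundary, this includes that the normal component of `α` vanishes
there in the weak sense. -/
def IsCodifferential [IsManifold I ∞ M] [MeasurableSpace M]
    (h : BilinField I M) (μ : Measure M)
    (α : OneForm I M) (f : M → ℝ) : Prop :=
  MemL2OneForm I h μ α ∧ MemLp f 2 μ ∧
    ∀ v : M → ℝ, ContMDiff I 𝓘(ℝ, ℝ) ∞ v →
      ∫ x, v x * f x ∂μ = ∫ x, dualMetric I h x (extDer I v x) (α x) ∂μ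

/-- `u` lies in the domain of the operator `-Δ_{h,μ} = d_μ^* d` (with Neumann boundary condition
if `M` has a boundary), and `-Δ_{h,μ} u = f`. -/
def IsNegLaplaceBeltrami [IsManifold I ∞ M] [MeasurableSpace M]
    (h : BilinField I M) (μ : Measure M)
    (u f : M → ℝ) : Prop :=
  ∃ α : OneForm I M, IsSobolevDifferential I h μ u α ∧ IsCodifferential I h μ α f

end LagrangianHeat

end

open scoped Matrix InnerProductSpace
set_option linter.unusedSectionVars false

/-! Conservation of mass. In a chart of `M` the density of μ(t) is ρ(t, Φ^t x) times the volume
density of the pulled back metric, and the latter is |det DΦ^t| · s, where s is the volume density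
of g at Φ^t x and the Jacobian is taken in charts (`volDensity_pullbackMetric`). Along a trajectory
the continuity equation gives ρ the derivative −ρ div V, Jacobi's formula for the linearized flow
gives the determinant the relative rate tr DV, and s has the derivative ds(V). As s div V = s tr DV
+ ds(V), the product has derivative zero (`hasDerivWithinAt_mass`). So the coordinate densities are
constant in time, the measures agree chart by chart (`massMeasure_eq`), and ρ stays positive along
the flow (`density_pos`).

Self-adjointness. By von Neumann's theorem it is enough that d, defined on smooth functions, is
densely defined and closable in L²: its closure T then has a self-adjoint T*T. Density is the
fundamental lemma of the calculus of variations. For closability, let w_n → 0 and dw_n → α in L².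
Integration by parts against test functions supported in the interior of chart domains shows that α
vanishes there, and the rest of each chart domain is a null set because the range of the model with
corners is convex (`frameForm_ae_eq_zero`).

The Hilbert space of one-forms. A measurable Parseval frame E_1, …, E_n of the metric, with n
possibly larger than d, replaces a one-form by its components α(E_j). This is an isometry into L²(μ;
ℝⁿ), and k ↦ ∑ k_j h(E_j, ·) is a contraction in the other direction. Closures and adjoints can
therefore be taken in L² spaces of functions, and `isNegLaplaceBeltrami_iff` translates the result
back to one-forms. -/

/-! ### Von Neumann's theorem on T*T -/

/-- Von Neumann's theorem: `T* T` is a densely defined self-adjoint operator if `T` is a closed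
densely defined operator, given by its graph `D`. -/
theorem exists_isSelfAdjoint_of_isClosed_graph {H K : Type*}
    [NormedAddCommGroup H] [InnerProductSpace ℝ H] [CompleteSpace H]
    [NormedAddCommGroup K] [InnerProductSpace ℝ K] [CompleteSpace K]
    (D : Submodule ℝ (WithLp 2 (H × K))) (hD : IsClosed (D : Set (WithLp 2 (H × K))))
    (hsv : ∀ p ∈ D, p.fst = 0 → p.snd = 0)
    (hdense : Dense {u : H | ∃ p ∈ D, p.fst = u}) :
    ∃ A : H →ₗ.[ℝ] H,
      (∀ u f : H, (u, f) ∈ A.graph ↔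
        ∃ p ∈ D, p.fst = u ∧ ∀ q ∈ D, ⟪q.fst, f⟫_ℝ = ⟪q.snd, p.snd⟫_ℝ) ∧
      Dense (A.domain : Set H) ∧ IsSelfAdjoint A := by
  have orth : ∀ w : H, (∀ q ∈ D, ⟪q.fst, w⟫_ℝ = 0) → w = 0 := fun w hw =>
    hdense.eq_zero_of_inner_right ℝ (by rintro _ ⟨p, hp, rfl⟩; exact hw p hp)
  let G : Submodule ℝ (H × H) :=
    { carrier := {x | ∃ p ∈ D, p.fst = x.1 ∧ ∀ q ∈ D, ⟪q.fst, x.2⟫_ℝ = ⟪q.snd, p.snd⟫_ℝ}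
      zero_mem' := ⟨0, D.zero_mem, by simp, by simp⟩
      add_mem' := by
        rintro x y ⟨p, hp, hx, h⟩ ⟨p', hp', hy, h'⟩
        refine ⟨p + p', D.add_mem hp hp', by simp [hx, hy], fun q hq => ?_⟩
        simp [inner_add_right, h q hq, h' q hq]
      smul_mem' := by
        rintro c x ⟨p, hp, hx, h⟩
        refine ⟨c • p, D.smul_mem c hp, by simp [hx], fun q hq => ?_⟩
        simp [inner_smul_right, h q hq] }
  have hG : ∀ x ∈ G, x.1 = 0 → x.2 = 0 := by
    rintro x ⟨p, hp, hx, h⟩ h0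
    refine orth _ fun q hq => ?_
    rw [h q hq, hsv p hp (hx.trans h0), inner_zero_right]
  -- Surjectivity of 1 + T*T: the orthogonal projection of (f, 0) onto the graph of T is some (u,
  -- Tu), and orthogonality of (f − u, −Tu) to the graph says that T*Tu = f − u.
  have hsolve : ∀ f : H, ∃ u, (u, f - u) ∈ G := by
    intro f
    have : CompleteSpace D := hD.completeSpace_coe
    obtain ⟨p, hp, h⟩ : ∃ p ∈ D, ∀ q ∈ D, ⟪q, WithLp.toLp 2 (f, (0 : K)) - p⟫_ℝ = 0 :=
      ⟨D.starProjection (WithLp.toLp 2 (f, 0)), D.starProjection_apply_mem _, fun q hq => by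
        rw [real_inner_comm]
        exact D.starProjection_inner_eq_zero _ q hq⟩
    refine ⟨p.fst, p, hp, rfl, fun q hq => ?_⟩
    have := h q hq
    simp only [WithLp.prod_inner_apply, WithLp.ofLp_sub, Prod.fst_sub, Prod.snd_sub,
      zero_sub, inner_neg_right] at this
    exact sub_eq_zero.1 (by simpa [sub_eq_add_neg] using this)
  have hsymm : ∀ x ∈ G, ∀ y ∈ G, ⟪x.1, y.2⟫_ℝ = ⟪x.2, y.1⟫_ℝ := by
    rintro x ⟨p, hp, hx, h⟩ y ⟨q, hq, hy, h'⟩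
    rw [← hx, ← hy, h' p hp, real_inner_comm q.fst, h q hq, real_inner_comm]
  have hgr : G.toLinearPMap.graph = G := Submodule.toLinearPMap_graph_eq G hG
  have hof : ∀ {u f : H}, (u, f) ∈ G →
      ∃ v : G.toLinearPMap.domain, (v : H) = u ∧ G.toLinearPMap v = f := fun {u f} h => by
    rw [← hgr] at h
    exact LinearPMap.mem_graph_iff _ |>.1 h
  have hdom : Dense (G.toLinearPMap.domain : Set H) := by
    rw [Submodule.dense_iff_topologicalClosure_eq_top, Submodule.topologicalClosure_eq_top_iff,
      Submodule.eq_bot_iff]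
    -- For w orthogonal to the domain write w = (1 + T*T)u. Testing with u gives −‖u‖² = ‖Tu‖², so u
    -- = 0 and Tu = 0; then w is orthogonal to the dense domain of T.
    intro w hw
    obtain ⟨u, p, hp, hpu, h⟩ := hsolve w
    obtain ⟨v, hv, -⟩ := hof (u := u) (f := w - u) ⟨p, hp, hpu, h⟩
    have h1 : ⟪u, w⟫_ℝ = 0 := hv ▸ hw v v.2
    have h2 := h p hp
    simp only at hpu h2
    rw [hpu, inner_sub_right, h1, real_inner_self_eq_norm_sq, real_inner_self_eq_norm_sq] at h2
    have h3 : u = 0 := by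
      rw [← norm_eq_zero]; nlinarith [sq_nonneg ‖u‖, sq_nonneg ‖p.snd‖]
    have h4 := hsv p hp (hpu.trans h3)
    refine orth w fun q hq => ?_
    simpa [h3, h4] using h q hq
  refine ⟨G.toLinearPMap, fun u f => by rw [hgr]; rfl, hdom, ?_⟩
  rw [LinearPMap.isSelfAdjoint_def]
  refine LinearPMap.eq_of_eq_graph ?_
  rw [LinearPMap.adjoint_graph_eq_graph_adjoint hdom, hgr]
  ext x
  rw [Submodule.mem_adjoint_iff]
  constructor
  · intro hx
    -- A symmetric A with 1 + A onto is self-adjoint: for (x₁, x₂) in the adjoint graph solve (1 +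
    -- A)u = x₁ + x₂ and (1 + A)v = x₁ − u. Symmetry gives ⟨(1 + A)v, x₁ − u⟩ = 0, that is x₁ = u.
    obtain ⟨u, hu⟩ := hsolve (x.1 + x.2)
    obtain ⟨v, hv⟩ := hsolve (x.1 - u)
    have h1 := hx _ _ hv
    have h2 := hsymm _ hv _ hu
    have h3 : x.1 - u = 0 := by
      rw [← inner_self_eq_zero (𝕜 := ℝ)]
      simp only [inner_add_right, inner_sub_left, inner_sub_right] at h1 h2 ⊢
      simp only [real_inner_comm u, real_inner_comm x.1 v] at h1 h2 ⊢
      linarith [real_inner_comm x.1 v, real_inner_comm u v, real_inner_comm u x.1]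
    have h4 : (u, x.1 + x.2 - u) = x := by
      rw [← sub_eq_zero.1 h3]
      ext <;> simp
    rwa [h4] at hu
  · intro hx a b hab
    rw [hsymm _ hab _ hx, sub_self]

/-! ### Smooth metrics and their volume densities in charts -/

namespace LagrangianHeat

variable {d : ℕ}
  {H : Type*} [TopologicalSpace H] {I : ModelWithCorners ℝ (EuclideanSpace ℝ (Fin d)) H}
  {M : Type*} [TopologicalSpace M] [ChartedSpace H M]
  {H' : Type*} [TopologicalSpace H'] {J : ModelWithCorners ℝ (EuclideanSpace ℝ (Fin d)) H'}
  {N : Type*} [TopologicalSpace N] [ChartedSpace H' N]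

variable (I) in
/-- A smooth Riemannian metric, with smoothness tested on local vector fields. -/
structure IsSmoothMetric [IsManifold I ∞ M] (h : BilinField I M) : Prop where
  symm : ∀ x u v, h x u v = h x v u
  pos : ∀ x v, v ≠ 0 → 0 < h x v v
  smooth : ∀ (s : Set M) (X Y : ∀ x : M, TangentSpace I x),
    ContMDiffOn I I.tangent ∞ (fun x => (⟨x, X x⟩ : TangentBundle I M)) s →
    ContMDiffOn I I.tangent ∞ (fun x => (⟨x, Y x⟩ : TangentBundle I M)) s →
    ContMDiffOn I 𝓘(ℝ, ℝ) ∞ (fun x => h x (X x) (Y x)) s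

theorem pullbackMetric_apply (F : M → N) (g : BilinField J N) (x : M) (u v : TangentSpace I x) :
    pullbackMetric I J F g x u v = g (F x) (mfderiv I J F x u) (mfderiv I J F x v) := rfl

theorem isSmoothMetric_inner [IsManifold J ∞ N]
    (g : Bundle.ContMDiffRiemannianMetric J ∞ (EuclideanSpace ℝ (Fin d))
      (fun y : N => TangentSpace J y)) : IsSmoothMetric J g.inner where
  symm := g.symm
  pos := g.pos
  smooth s X Y hX hY := by
    intro x hx
    have : ContMDiffWithinAt J (J.prod 𝓘(ℝ)) ∞
        (fun m ↦ Bundle.TotalSpace.mk' ℝ (E := Bundle.Trivial N ℝ) m (g.inner m (X m) (Y m))) s x := by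
      apply ContMDiffWithinAt.clm_bundle_apply₂ (F₁ := EuclideanSpace ℝ (Fin d))
        (F₂ := EuclideanSpace ℝ (Fin d))
      · exact g.contMDiff.contMDiffAt.contMDiffWithinAt
      · exact hX x hx
      · exact hY x hx
    simp only [Bundle.contMDiffWithinAt_totalSpace] at this
    exact this.2

/-- Injectivity of the differentials gives positivity. Smoothness needs no pullback bundle: the
tangent map of `F` carries a local vector field to a smooth map into the tangent bundle of `N`, on
which the metric of `N` is evaluated. -/
theorem IsEmbedded.isSmoothMetric_pullbackMetric [IsManifold I ∞ M] [IsManifold J ∞ N]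
    {F : M → N} (hF : IsEmbedded I J F)
    (g : Bundle.ContMDiffRiemannianMetric J ∞ (EuclideanSpace ℝ (Fin d))
      (fun y : N => TangentSpace J y)) : IsSmoothMetric I (pullbackMetric I J F g.inner) where
  symm x u v := g.symm _ _ _
  pos x v hv := g.pos _ _ fun h => hv (hF.immersive x (h.trans (map_zero _).symm))
  smooth s X Y hX hY := by
    intro x hx
    have hT : ContMDiff I.tangent J.tangent ∞ (tangentMap I J F) :=
      hF.smooth.contMDiff_tangentMap le_rfl
    have : ContMDiffWithinAt I (J.prod 𝓘(ℝ)) ∞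
        (fun m ↦ Bundle.TotalSpace.mk' ℝ (E := Bundle.Trivial N ℝ) (F m)
          (g.inner (F m) (mfderiv I J F m (X m)) (mfderiv I J F m (Y m)))) s x := by
      apply ContMDiffWithinAt.clm_bundle_apply₂ (F₁ := EuclideanSpace ℝ (Fin d))
        (F₂ := EuclideanSpace ℝ (Fin d))
      · exact ContMDiffAt.comp_contMDiffWithinAt x g.contMDiff.contMDiffAt
          hF.smooth.contMDiffAt.contMDiffWithinAt
      · exact hT.contMDiffAt.comp_contMDiffWithinAt x (hX x hx)
      · exact hT.contMDiffAt.comp_contMDiffWithinAt x (hY x hx)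
    simp only [Bundle.contMDiffWithinAt_totalSpace] at this
    exact this.2

variable (I) in
/-- The coordinate vector field `∂_i` of the chart around `x₀`, as a vector field on `M`
(zero off the domain of the chart). -/
noncomputable def coordField [IsManifold I ∞ M] (x₀ : M) (i : Fin d) (x : M) : TangentSpace I x :=
  (trivializationAt (EuclideanSpace ℝ (Fin d)) (TangentSpace I) x₀).localFrame
    (EuclideanSpace.basisFun (Fin d) ℝ).toBasis i x

variable [IsManifold I ∞ M]

theorem contMDiffOn_coordField (x₀ : M) (i : Fin d) :
    ContMDiffOn I I.tangent ∞ (fun x => (⟨x, coordField I x₀ i x⟩ : TangentBundle I M))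
      (extChartAt I x₀).source := by
  rw [extChartAt_source]
  exact (trivializationAt (EuclideanSpace ℝ (Fin d)) (TangentSpace I)
    x₀).contMDiffOn_localFrame_baseSet
    (I := I) ∞ (EuclideanSpace.basisFun (Fin d) ℝ).toBasis i

theorem coordField_eq_basisAt (x₀ : M) {x : M} (hx : x ∈ (chartAt H x₀).source) (i : Fin d) :
    coordField I x₀ i x = (trivializationAt (EuclideanSpace ℝ (Fin d)) (TangentSpace I) x₀).basisAt
      (EuclideanSpace.basisFun (Fin d) ℝ).toBasis hx i :=
  Bundle.Trivialization.localFrame_apply_of_mem_baseSet _ _ hx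

/-- Links the coordinate vectors in the definition of the volume, which are derivatives of the
inverse chart, to a local frame of the tangent bundle that is known to be smooth and linearly
independent. -/
theorem coordVec_eq (x₀ : M) {y : EuclideanSpace ℝ (Fin d)} (hy : y ∈ (extChartAt I x₀).target)
    (i : Fin d) : coordVec I x₀ y i = coordField I x₀ i ((extChartAt I x₀).symm y) := by
  have h := (extChartAt I x₀).map_target hy
  rw [extChartAt_source] at h
  have h2 := TangentBundle.symmL_trivializationAt (I := I) h
  rw [(extChartAt I x₀).right_inv hy] at h2
  rw [coordField_eq_basisAt x₀ h, coordVec, ← h2]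
  simp only [Bundle.Trivialization.basisAt]
  erw [Module.Basis.map_apply]
  rw [OrthonormalBasis.coe_toBasis, EuclideanSpace.basisFun_apply]
  exact Bundle.Trivialization.symmL_apply (R := ℝ)
    (trivializationAt (EuclideanSpace ℝ (Fin d)) (TangentSpace I) x₀) h
    (EuclideanSpace.single i (1 : ℝ))

theorem linearIndependent_coordField (x₀ : M) {x : M} (hx : x ∈ (extChartAt I x₀).source) :
    LinearIndependent ℝ (fun i => coordField I x₀ i x) := by
  rw [extChartAt_source] at hx
  simp_rw [coordField_eq_basisAt x₀ hx]
  exact Module.Basis.linearIndependent _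

theorem exists_eq_sum_coordField (x₀ : M) {x : M} (hx : x ∈ (extChartAt I x₀).source)
    (v : TangentSpace I x) : ∃ c : Fin d → ℝ, v = ∑ i, c i • coordField I x₀ i x := by
  rw [extChartAt_source] at hx
  simp_rw [coordField_eq_basisAt x₀ hx]
  exact ⟨_, (Module.Basis.sum_repr _ v).symm⟩

/-- The coefficients `h(∂_i, ∂_j)` of a metric in the chart around `x₀`. -/
noncomputable def coordGram (h : BilinField I M) (x₀ : M) (x : M) : Matrix (Fin d) (Fin d) ℝ :=
  Matrix.of fun i j => h x (coordField I x₀ i x) (coordField I x₀ j x)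

theorem volDensity_eq (h : BilinField I M) (x₀ : M) {y : EuclideanSpace ℝ (Fin d)}
    (hy : y ∈ (extChartAt I x₀).target) :
    volDensity I h x₀ y = Real.sqrt (coordGram h x₀ ((extChartAt I x₀).symm y)).det := by
  simp only [volDensity, coordGram, coordVec_eq x₀ hy]

theorem IsSmoothMetric.contMDiffOn_det_coordGram {h : BilinField I M} (hh : IsSmoothMetric I h)
    (x₀ : M) :
    ContMDiffOn I 𝓘(ℝ, ℝ) ∞ (fun x => (coordGram h x₀ x).det) (extChartAt I x₀).source := by
  have h1 : ∀ i j, ContMDiffOn I 𝓘(ℝ, ℝ) ∞ (fun x => coordGram h x₀ x i j)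
      (extChartAt I x₀).source := fun i j =>
    hh.smooth _ _ _ (contMDiffOn_coordField x₀ i) (contMDiffOn_coordField x₀ j)
  simp only [Matrix.det_apply']
  exact contMDiffOn_finsetSum fun σ _ => contMDiffOn_const.mul
    (contMDiffOn_finsetProd fun i _ => h1 _ _)

/-- The Gram matrix of linearly independent vectors is positive definite, hence has positive
determinant. -/
theorem IsSmoothMetric.det_coordGram_pos {h : BilinField I M} (hh : IsSmoothMetric I h)
    (x₀ : M) {x : M} (hx : x ∈ (extChartAt I x₀).source) : 0 < (coordGram h x₀ x).det := by
  refine (Matrix.PosDef.of_dotProduct_mulVec_pos ?_ fun c hc => ?_).det_pos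
  · ext i j
    exact hh.symm _ _ _
  · have h1 : star c ⬝ᵥ (coordGram h x₀ x *ᵥ c) =
        h x (∑ i, c i • coordField I x₀ i x) (∑ i, c i • coordField I x₀ i x) := by
      simp only [map_sum, map_smul, sum_apply, dotProduct, Matrix.mulVec,
        coordGram, Matrix.of_apply, star_trivial, smul_apply, smul_eq_mul]
      refine Finset.sum_congr rfl fun i _ => ?_
      refine congrArg (c i * ·) (Finset.sum_congr rfl fun j _ => ?_)
      rw [hh.symm, mul_comm]
    rw [h1]
    refine hh.pos _ _ fun h0 => hc ?_
    exact funext (Fintype.linearIndependent_iff.1 (linearIndependent_coordField x₀ hx) c h0)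

theorem IsSmoothMetric.contDiffOn_volDensity {h : BilinField I M} (hh : IsSmoothMetric I h)
    (x₀ : M) : ContDiffOn ℝ ∞ (volDensity I h x₀) (extChartAt I x₀).target := by
  have h1 : ContDiffOn ℝ ∞ (fun y => (coordGram h x₀ ((extChartAt I x₀).symm y)).det)
      (extChartAt I x₀).target :=
    ((hh.contMDiffOn_det_coordGram x₀).comp (contMDiffOn_extChartAt_symm x₀)
      (fun y hy => (extChartAt I x₀).map_target hy)).contDiffOn
  exact (h1.sqrt fun y hy => (hh.det_coordGram_pos x₀ ((extChartAt I x₀).map_target hy)).ne').congr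
    fun y hy => volDensity_eq h x₀ hy

theorem IsSmoothMetric.volDensity_pos {h : BilinField I M} (hh : IsSmoothMetric I h)
    (x₀ : M) {y : EuclideanSpace ℝ (Fin d)} (hy : y ∈ (extChartAt I x₀).target) :
    0 < volDensity I h x₀ y := by
  rw [volDensity_eq h x₀ hy]
  exact Real.sqrt_pos.2 (hh.det_coordGram_pos x₀ ((extChartAt I x₀).map_target hy))

end LagrangianHeat

/-! ### Change of variables for the Riemannian volume -/

theorem LinearMap.BilinForm.det_comp_euclidean {d : ℕ}
    (B : LinearMap.BilinForm ℝ (EuclideanSpace ℝ (Fin d)))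
    (L : EuclideanSpace ℝ (Fin d) →L[ℝ] EuclideanSpace ℝ (Fin d)) :
    (Matrix.of fun i j : Fin d => B (L (EuclideanSpace.single i 1))
      (L (EuclideanSpace.single j 1))).det =
    L.det ^ 2 * (Matrix.of fun i j : Fin d => B (EuclideanSpace.single i 1)
      (EuclideanSpace.single j 1)).det := by
  set b := (EuclideanSpace.basisFun (Fin d) ℝ).toBasis with hb
  have h1 : (Matrix.of fun i j : Fin d => B (L (EuclideanSpace.single i 1))
      (L (EuclideanSpace.single j 1))) = LinearMap.toMatrix₂ b b
        (B.compl₁₂ (L : EuclideanSpace ℝ (Fin d) →ₗ[ℝ] EuclideanSpace ℝ (Fin d)) L) := by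
    ext i j
    simp [hb, LinearMap.toMatrix₂_apply]
  have h2 : (Matrix.of fun i j : Fin d => B (EuclideanSpace.single i 1)
      (EuclideanSpace.single j 1)) = LinearMap.toMatrix₂ b b B := by
    ext i j
    simp [hb, LinearMap.toMatrix₂_apply]
  rw [h1, h2, LinearMap.toMatrix₂_compl₁₂ b b b b, Matrix.det_mul, Matrix.det_mul,
    Matrix.det_transpose, LinearMap.det_toMatrix]
  rw [ContinuousLinearMap.det]
  ring

theorem ContinuousOn.measurableSet_inter_preimage {X Y : Type*} [TopologicalSpace X]
    [MeasurableSpace X] [OpensMeasurableSpace X] [TopologicalSpace Y] [MeasurableSpace Y]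
    [BorelSpace Y] {f : X → Y} {s : Set X} (hf : ContinuousOn f s) (hs : MeasurableSet s)
    {t : Set Y} (ht : MeasurableSet t) : MeasurableSet (s ∩ f ⁻¹' t) := by
  have h := MeasurableSet.subtype_image hs (hf.domRestrict.measurable ht)
  rwa [show s ∩ f ⁻¹' t = Subtype.val '' (s.domRestrict f ⁻¹' t) by
    ext x; simp [and_comm]]

namespace LagrangianHeat

variable {d : ℕ}
  {H : Type*} [TopologicalSpace H] {I : ModelWithCorners ℝ (EuclideanSpace ℝ (Fin d)) H}
  {M : Type*} [TopologicalSpace M] [ChartedSpace H M]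
  {H' : Type*} [TopologicalSpace H'] {J : ModelWithCorners ℝ (EuclideanSpace ℝ (Fin d)) H'}
  {N : Type*} [TopologicalSpace N] [ChartedSpace H' N]

theorem measurableSet_extChartAt_target (x₀ : M) :
    MeasurableSet (extChartAt I x₀).target := by
  rw [extChartAt_target]
  exact (((chartAt H x₀).open_target.preimage I.continuous_symm).measurableSet).inter
    I.isClosed_range.measurableSet

variable [IsManifold I ∞ M] [IsManifold J ∞ N]

/-- The chain rule for one map written in two ways: `F` after the inverse chart of `M`, and the
inverse chart of `N` after the coordinate expression of `F`. The two agree near `y` within `range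
I`, where derivatives are unique. -/
theorem mfderivWithin_range_chart_comp {F : M → N} (x₀ : M) (q : N) {y : EuclideanSpace ℝ (Fin d)}
    (hy : y ∈ (extChartAt I x₀).target)
    (hF : MDifferentiableAt I J F ((extChartAt I x₀).symm y))
    (hq : F ((extChartAt I x₀).symm y) ∈ (extChartAt J q).source)
    (e : EuclideanSpace ℝ (Fin d)) :
    (mfderiv I J F ((extChartAt I x₀).symm y)
      (mfderivWithin 𝓘(ℝ, EuclideanSpace ℝ (Fin d)) I (extChartAt I x₀).symm (range I) y e :
        TangentSpace I ((extChartAt I x₀).symm y)) : EuclideanSpace ℝ (Fin d)) =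
    (mfderivWithin 𝓘(ℝ, EuclideanSpace ℝ (Fin d)) J (extChartAt J q).symm (range J)
      (extChartAt J q (F ((extChartAt I x₀).symm y)))
      (fderivWithin ℝ (extChartAt J q ∘ F ∘ (extChartAt I x₀).symm) (range I) y e) :
        EuclideanSpace ℝ (Fin d)) := by
  have hu : UniqueMDiffWithinAt 𝓘(ℝ, EuclideanSpace ℝ (Fin d)) (range I) y :=
    (I.uniqueDiffOn y (extChartAt_target_subset_range x₀ hy)).uniqueMDiffWithinAt
  have hψ := (mdifferentiableWithinAt_extChartAt_symm (I := I) hy).hasMFDerivWithinAt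
  have hKy := (extChartAt J q).map_source hq
  have hφs := (mdifferentiableWithinAt_extChartAt_symm (I := J) hKy).hasMFDerivWithinAt
  have hφ : HasMFDerivAt J 𝓘(ℝ, EuclideanSpace ℝ (Fin d)) (extChartAt J q)
      (F ((extChartAt I x₀).symm y)) _ :=
    (mdifferentiableAt_extChartAt (by rwa [extChartAt_source] at hq)).hasMFDerivAt
  have h1 := hF.hasMFDerivAt.comp_hasMFDerivWithinAt y hψ
  have hK : HasMFDerivWithinAt 𝓘(ℝ, EuclideanSpace ℝ (Fin d)) 𝓘(ℝ, EuclideanSpace ℝ (Fin d))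
      (extChartAt J q ∘ F ∘ (extChartAt I x₀).symm) (range I) y
      (fderivWithin ℝ (extChartAt J q ∘ F ∘ (extChartAt I x₀).symm) (range I) y) :=
    (hφ.comp_hasMFDerivWithinAt y h1).mdifferentiableWithinAt.differentiableWithinAt
      |>.hasFDerivWithinAt.hasMFDerivWithinAt
  have hm : range I ⊆ (extChartAt J q ∘ F ∘ (extChartAt I x₀).symm) ⁻¹' (range J) :=
    fun z _ => mem_range_self _
  have h2 := HasMFDerivWithinAt.comp y hφs hK hm
  have hev : (F ∘ (extChartAt I x₀).symm) =ᶠ[𝓝[range I] y] (extChartAt J q).symm ∘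
      (extChartAt J q ∘ F ∘ (extChartAt I x₀).symm) := by
    have hc : ContinuousWithinAt (F ∘ (extChartAt I x₀).symm) (range I) y :=
      h1.continuousWithinAt
    filter_upwards [hc.preimage_mem_nhdsWithin (extChartAt_source_mem_nhds' hq)] with z hz
    exact ((extChartAt J q).left_inv hz).symm
  have h3 := h2.congr_of_eventuallyEq hev ((extChartAt J q).left_inv hq).symm
  exact congrArg (fun L : EuclideanSpace ℝ (Fin d) →L[ℝ] EuclideanSpace ℝ (Fin d) => L e)
    (hu.eq h1 h3)

/-- The Gram matrix of the pullback is LᵀGL, where L is the Jacobian of `F` in the charts. This is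
used twice: `F = id` gives the transition rule between charts, and `F = Φ t` splits off the Jacobian
of the flow. -/
theorem volDensity_pullbackMetric {F : M → N} (g : BilinField J N)
    (x₀ : M) (q : N) {y : EuclideanSpace ℝ (Fin d)} (hy : y ∈ (extChartAt I x₀).target)
    (hF : MDifferentiableAt I J F ((extChartAt I x₀).symm y))
    (hq : F ((extChartAt I x₀).symm y) ∈ (extChartAt J q).source) :
    volDensity I (pullbackMetric I J F g) x₀ y =
      |(fderivWithin ℝ (extChartAt J q ∘ F ∘ (extChartAt I x₀).symm) (range I) y).det| *
        volDensity J g q (extChartAt J q (F ((extChartAt I x₀).symm y))) := by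
  have hp : (extChartAt J q).symm (extChartAt J q (F ((extChartAt I x₀).symm y))) =
    F ((extChartAt I x₀).symm y) := (extChartAt J q).left_inv hq
  set K' := fderivWithin ℝ (extChartAt J q ∘ F ∘ (extChartAt I x₀).symm) (range I) y
  -- The base points are equal only by a proof, and the type of `g p` depends on `p`. With vectors
  -- taken in the model space, the equality can be substituted.
  have hg : ∀ (p p' : N), p = p' → ∀ u v : EuclideanSpace ℝ (Fin d),
      (g p : EuclideanSpace ℝ (Fin d) →L[ℝ] EuclideanSpace ℝ (Fin d) →L[ℝ] ℝ) u v =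
      (g p' : EuclideanSpace ℝ (Fin d) →L[ℝ] EuclideanSpace ℝ (Fin d) →L[ℝ] ℝ) u v := by
    rintro p _ rfl u v
    rfl
  set G : EuclideanSpace ℝ (Fin d) →L[ℝ] EuclideanSpace ℝ (Fin d) →L[ℝ] ℝ :=
    g ((extChartAt J q).symm (extChartAt J q (F ((extChartAt I x₀).symm y))))
  set D : EuclideanSpace ℝ (Fin d) →L[ℝ] EuclideanSpace ℝ (Fin d) :=
    mfderivWithin 𝓘(ℝ, EuclideanSpace ℝ (Fin d)) J (extChartAt J q).symm (range J)
      (extChartAt J q (F ((extChartAt I x₀).symm y)))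
  let B : LinearMap.BilinForm ℝ (EuclideanSpace ℝ (Fin d)) :=
    LinearMap.mk₂ ℝ (fun u v => G (D u) (D v)) (by simp) (by simp) (by simp) (by simp)
  have h1 : volDensity I (pullbackMetric I J F g) x₀ y = √(Matrix.of fun i j : Fin d =>
      B (K' (EuclideanSpace.single i 1)) (K' (EuclideanSpace.single j 1))).det := by
    unfold volDensity
    congr 3
    funext i j
    rw [pullbackMetric_apply]
    refine (hg _ _ hp.symm _ _).trans ?_
    have h2 := mfderivWithin_range_chart_comp x₀ q hy hF hq (EuclideanSpace.single i (1 : ℝ))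
    have h3 := mfderivWithin_range_chart_comp x₀ q hy hF hq (EuclideanSpace.single j (1 : ℝ))
    exact congrArg₂ (fun u v => G u v) h2 h3
  rw [h1, LinearMap.BilinForm.det_comp_euclidean, Real.sqrt_mul (sq_nonneg _), Real.sqrt_sq_eq_abs]
  rfl

theorem volDensity_eq_abs_det_mul (h : BilinField I M) (x₀ x₁ : M) {y : EuclideanSpace ℝ (Fin d)}
    (hy : y ∈ (extChartAt I x₀).target)
    (hq : (extChartAt I x₀).symm y ∈ (extChartAt I x₁).source) :
    volDensity I h x₀ y =
      |(fderivWithin ℝ (extChartAt I x₁ ∘ (extChartAt I x₀).symm) (range I) y).det| *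
        volDensity I h x₁ (extChartAt I x₁ ((extChartAt I x₀).symm y)) := by
  have h1 : pullbackMetric I I (id : M → M) h = h := by
    funext x
    ext u v
    rw [pullbackMetric_apply, mfderiv_id]
    rfl
  have := volDensity_pullbackMetric (F := id) h x₀ x₁ hy mdifferentiableAt_id hq
  rw [h1] at this
  exact this

section Measure

variable [MeasurableSpace M] [BorelSpace M]

theorem chartVolume_apply (h : BilinField I M) (x₀ : M) {S : Set M}
    (hS : MeasurableSet S) : chartVolume I h x₀ S =
      ∫⁻ y in (extChartAt I x₀).target ∩ (extChartAt I x₀).symm ⁻¹' S,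
        ENNReal.ofReal (volDensity I h x₀ y) := by
  have hT := measurableSet_extChartAt_target (I := I) x₀
  have hm : AEMeasurable (extChartAt I x₀).symm
      (((volume : Measure (EuclideanSpace ℝ (Fin d))).restrict
        (extChartAt I x₀).target).withDensity
        fun y => ENNReal.ofReal (volDensity I h x₀ y)) :=
    ((continuousOn_extChartAt_symm x₀).aemeasurable hT).mono_ac
      (withDensity_absolutelyContinuous _ _)
  rw [chartVolume, Measure.map_apply_of_aemeasurable hm hS, withDensity_apply',
    Measure.restrict_restrict' hT, inter_comm]

/-- The change of variables formula for the transition map τ. The inequality alone is enough to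
identify the supremum over all charts. -/
theorem chartVolume_restrict_le (h : BilinField I M) (x₀ x₁ : M) :
    (chartVolume I h x₀).restrict (extChartAt I x₁).source ≤ chartVolume I h x₁ := by
  refine Measure.le_iff.2 fun S hS => ?_
  have hsrc : MeasurableSet (extChartAt I x₁).source := (isOpen_extChartAt_source x₁).measurableSet
  rw [Measure.restrict_apply hS, chartVolume_apply h x₀ (hS.inter hsrc), chartVolume_apply h x₁ hS]
  set A := (extChartAt I x₀).target ∩ (extChartAt I x₀).symm ⁻¹' (S ∩ (extChartAt I x₁).source)
    with hA
  set τ := extChartAt I x₁ ∘ (extChartAt I x₀).symm with hτ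
  have hAm : MeasurableSet A := (continuousOn_extChartAt_symm x₀).measurableSet_inter_preimage
    (measurableSet_extChartAt_target x₀) (hS.inter hsrc)
  have hd : ∀ y ∈ A, HasFDerivWithinAt τ (fderivWithin ℝ τ (range I) y) A y := by
    rintro y ⟨hy, -, hy'⟩
    have hy2 : y ∈ ((extChartAt I x₀).symm.trans (extChartAt I x₁)).source := by
      rw [PartialEquiv.trans_source]; exact ⟨hy, hy'⟩
    exact ((contDiffWithinAt_ext_coord_change (n := ∞) x₁ x₀ hy2).differentiableWithinAt
      (by simp)).hasFDerivWithinAt.mono fun z hz => extChartAt_target_subset_range x₀ hz.1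
  have hinj : InjOn τ A := by
    rintro y ⟨hy, -, hy'⟩ z ⟨hz, -, hz'⟩ hyz
    exact (extChartAt I x₀).symm.injOn hy hz ((extChartAt I x₁).injOn hy' hz' hyz)
  calc ∫⁻ y in A, ENNReal.ofReal (volDensity I h x₀ y)
      = ∫⁻ y in A, ENNReal.ofReal |(fderivWithin ℝ τ (range I) y).det| *
          ENNReal.ofReal (volDensity I h x₁ (τ y)) := by
        refine setLIntegral_congr_fun hAm fun y hy => ?_
        rw [← ENNReal.ofReal_mul (abs_nonneg _), volDensity_eq_abs_det_mul h x₀ x₁ hy.1 hy.2.2]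
        rfl
    _ = ∫⁻ y in τ '' A, ENNReal.ofReal (volDensity I h x₁ y) :=
        (lintegral_image_eq_lintegral_abs_det_fderiv_mul volume hAm hd hinj
          fun y => ENNReal.ofReal (volDensity I h x₁ y)).symm
    _ ≤ _ := by
        refine lintegral_mono_set ?_
        rintro _ ⟨y, ⟨-, hyS, hy'⟩, rfl⟩
        refine ⟨(extChartAt I x₁).map_source hy', ?_⟩
        rw [mem_preimage, hτ, Function.comp_apply, (extChartAt I x₁).left_inv hy']
        exact hyS

theorem chartVolume_compl_source (h : BilinField I M) (x₀ : M) :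
    chartVolume I h x₀ (extChartAt I x₀).sourceᶜ = 0 := by
  rw [chartVolume_apply h x₀ (isOpen_extChartAt_source x₀).measurableSet.compl]
  convert! setLIntegral_empty _
  ext y
  simp only [mem_inter_iff, mem_preimage, mem_compl_iff, mem_empty_iff_false, iff_false, not_and,
    not_not]
  exact fun hy => (extChartAt I x₀).map_target hy

/-- Each chart volume is at most the one of `x₀` plus the part of `riemVolume` off the chart domain.
The supremum satisfies the same bound, and restriction to the domain removes the second term. -/
theorem riemVolume_restrict_source (h : BilinField I M) (x₀ : M) :
    (riemVolume I h).restrict (extChartAt I x₀).source = chartVolume I h x₀ := by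
  have hsrc : MeasurableSet (extChartAt I x₀).source := (isOpen_extChartAt_source x₀).measurableSet
  have hle : ∀ x, chartVolume I h x ≤ riemVolume I h := fun x => le_iSup (chartVolume I h) x
  refine le_antisymm ?_ ?_
  · have h1 : riemVolume I h ≤ chartVolume I h x₀ +
        (riemVolume I h).restrict (extChartAt I x₀).sourceᶜ := by
      refine iSup_le fun x => ?_
      rw [← Measure.restrict_add_restrict_compl (μ := chartVolume I h x) hsrc]
      exact add_le_add (chartVolume_restrict_le h x x₀) (Measure.restrict_mono le_rfl (hle x))
    refine (Measure.restrict_mono (le_refl (extChartAt I x₀).source) h1).trans ?_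
    rw [Measure.restrict_add, Measure.restrict_restrict hsrc, inter_compl_self,
      Measure.restrict_empty, add_zero]
    exact Measure.restrict_le_self
  · rw [← Measure.restrict_add_restrict_compl (μ := chartVolume I h x₀) hsrc,
      Measure.restrict_eq_zero.2 (chartVolume_compl_source h x₀), add_zero]
    exact Measure.restrict_mono le_rfl (hle x₀)

theorem IsSmoothMetric.isLocallyFiniteMeasure_riemVolume {h : BilinField I M}
    (hh : IsSmoothMetric I h) : IsLocallyFiniteMeasure (riemVolume I h) := by
  refine ⟨fun x => ?_⟩
  have hx := mem_extChartAt_target (I := I) x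
  have hc := (hh.contDiffOn_volDensity x).continuousOn _ hx
  obtain ⟨r, hr, hb⟩ : ∃ r > 0, ∀ y ∈ Metric.ball (extChartAt I x x) r ∩ (extChartAt I x).target,
      volDensity I h x y < volDensity I h x (extChartAt I x x) + 1 := by
    have := hc.preimage_mem_nhdsWithin (Iio_mem_nhds (lt_add_one _))
    obtain ⟨r, hr, hb⟩ := Metric.mem_nhdsWithin_iff.1 this
    exact ⟨r, hr, fun y hy => hb hy⟩
  have hU : IsOpen ((extChartAt I x).source ∩
      extChartAt I x ⁻¹' Metric.ball (extChartAt I x x) r) :=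
    (continuousOn_extChartAt x).isOpen_inter_preimage (isOpen_extChartAt_source x)
      Metric.isOpen_ball
  refine ⟨_, hU.mem_nhds ⟨mem_extChartAt_source x, Metric.mem_ball_self hr⟩, ?_⟩
  rw [← Measure.restrict_eq_self (riemVolume I h) inter_subset_left, riemVolume_restrict_source,
    chartVolume_apply h x hU.measurableSet]
  set A := (extChartAt I x).target ∩ (extChartAt I x).symm ⁻¹' ((extChartAt I x).source ∩
      extChartAt I x ⁻¹' Metric.ball (extChartAt I x x) r)
  have hA : A ⊆ Metric.ball (extChartAt I x x) r ∩ (extChartAt I x).target := by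
    rintro y ⟨hy, -, hy'⟩
    rw [mem_preimage, (extChartAt I x).right_inv hy] at hy'
    exact ⟨hy', hy⟩
  calc ∫⁻ y in A, ENNReal.ofReal (volDensity I h x y)
      ≤ ∫⁻ y in A, ENNReal.ofReal (volDensity I h x (extChartAt I x x) + 1) :=
        setLIntegral_mono measurable_const fun y hy => ENNReal.ofReal_le_ofReal (hb y (hA hy)).le
    _ < ⊤ := by
        rw [setLIntegral_const]
        exact ENNReal.mul_lt_top ENNReal.ofReal_lt_top
          ((measure_mono fun y hy => (hA hy).1).trans_lt measure_ball_lt_top)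

end Measure

end LagrangianHeat

/-! ### Jacobi's formula and the linearized flow -/

/-- Jacobi's formula for A' = LA, without invertibility of A: differentiating the i-th row replaces
it by ∑ L_ik A_k, and of this combination of the rows of A only L_ii A_i contributes to the
determinant. -/
theorem Matrix.hasDerivWithinAt_det {n : Type*} [Fintype n] [DecidableEq n]
    {A : ℝ → Matrix n n ℝ} {L : Matrix n n ℝ} {s : Set ℝ} {t : ℝ}
    (h : ∀ i j, HasDerivWithinAt (fun t => A t i j) ((L * A t) i j) s t) :
    HasDerivWithinAt (fun t => (A t).det) (L.trace * (A t).det) s t := by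
  have h1 : L.trace * (A t).det =
      ∑ i, ∑ σ : Equiv.Perm n, ((Equiv.Perm.sign σ : ℤ) : ℝ) *
        ((∏ j ∈ Finset.univ.erase i, A t j (σ j)) * (L * A t) i (σ i)) := by
    have h2 : ∀ i, L i i * (A t).det = ((A t).updateRow i (∑ k, L i k • A t k)).det := fun i =>
      (Matrix.det_updateRow_sum (A t) i (L i)).symm
    simp only [Matrix.trace, Matrix.diag, Finset.sum_mul, h2]
    refine Finset.sum_congr rfl fun i _ => ?_
    rw [← Matrix.det_transpose, Matrix.det_apply']
    refine Finset.sum_congr rfl fun σ _ => congrArg _ ?_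
    rw [← Finset.prod_erase_mul _ _ (Finset.mem_univ i)]
    congr 1
    · refine Finset.prod_congr rfl fun j hj => ?_
      rw [Matrix.transpose_apply, Matrix.updateRow_ne (Finset.ne_of_mem_erase hj)]
    · simp [Matrix.transpose_apply, Matrix.mul_apply]
  rw [h1, Finset.sum_comm]
  have h3 : (fun t => (A t).det) = fun t => ∑ σ : Equiv.Perm n,
      ((Equiv.Perm.sign σ : ℤ) : ℝ) * ∏ i, A t i (σ i) := by
    funext t
    rw [← Matrix.det_transpose, Matrix.det_apply']
    rfl
  rw [h3]
  refine HasDerivWithinAt.fun_sum fun σ _ => ?_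
  rw [← Finset.mul_sum]
  exact (HasDerivWithinAt.fun_finsetProd fun i _ => h i (σ i)).const_mul _

theorem ContinuousLinearMap.hasDerivWithinAt_det {d : ℕ}
    {A : ℝ → EuclideanSpace ℝ (Fin d) →L[ℝ] EuclideanSpace ℝ (Fin d)}
    {L : EuclideanSpace ℝ (Fin d) →L[ℝ] EuclideanSpace ℝ (Fin d)} {s : Set ℝ} {t : ℝ}
    (h : HasDerivWithinAt A (L.comp (A t)) s t) :
    HasDerivWithinAt (fun t => (A t).det)
      (LinearMap.trace ℝ (EuclideanSpace ℝ (Fin d)) L * (A t).det) s t := by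
  set b := (EuclideanSpace.basisFun (Fin d) ℝ).toBasis with hb
  have h0 : ∀ B : EuclideanSpace ℝ (Fin d) →L[ℝ] EuclideanSpace ℝ (Fin d),
      B.det = (LinearMap.toMatrix b b B).det := fun B => (LinearMap.det_toMatrix b _).symm
  simp only [h0, LinearMap.trace_eq_matrix_trace ℝ b]
  refine Matrix.hasDerivWithinAt_det fun i j => ?_
  rw [← LinearMap.toMatrix_mul]
  have h1 : ∀ B : EuclideanSpace ℝ (Fin d) →L[ℝ] EuclideanSpace ℝ (Fin d),
      LinearMap.toMatrix b b B i j =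
        (EuclideanSpace.proj i : EuclideanSpace ℝ (Fin d) →L[ℝ] ℝ) (B (b j)) := fun B => by
    simp [LinearMap.toMatrix_apply, hb]
  simp only [h1]
  have h2 := (EuclideanSpace.proj i : EuclideanSpace ℝ (Fin d) →L[ℝ] ℝ).hasFDerivAt.comp_hasDerivWithinAt t
    (h.clm_apply (hasDerivWithinAt_const t s (b j)))
  simpa [LinearMap.toMatrix_apply, hb, Function.comp_def] using h2

/-- Differentiating the flow equation in space: the Jacobian of a flow solves the linearized
equation. -/
theorem hasDerivWithinAt_fderivWithin_flow {E : Type*} [NormedAddCommGroup E] [NormedSpace ℝ E]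
    {T t₀ : ℝ} (hT : 0 < T) (ht₀ : t₀ ∈ Icc 0 T) {R R' : Set E} (hR : UniqueDiffOn ℝ R)
    {y : E} (hy : y ∈ R) (hyc : y ∈ closure (interior R)) {F : ℝ × E → E}
    (hF : ContDiffWithinAt ℝ ∞ F (Icc 0 T ×ˢ R) (t₀, y)) {v : E → E} {Dv : E →L[ℝ] E}
    (hv : HasFDerivWithinAt v Dv R' (F (t₀, y))) (hm : MapsTo (fun z => F (t₀, z)) R R')
    (hode : ∀ᶠ z in 𝓝[R] y, HasDerivWithinAt (fun t => F (t, z)) (v (F (t₀, z))) (Icc 0 T) t₀) :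
    HasDerivWithinAt (fun t => fderivWithin ℝ (fun z => F (t, z)) R y)
      (Dv.comp (fderivWithin ℝ (fun z => F (t₀, z)) R y)) (Icc 0 T) t₀ := by
  set S := Icc 0 T ×ˢ R with hS
  have hIcc := uniqueDiffOn_Icc hT
  have hSu : UniqueDiffOn ℝ S := hIcc.prod hR
  have hp : (t₀, y) ∈ S := ⟨ht₀, hy⟩
  -- The second derivative within `S` is symmetric also at boundary points, provided that they are
  -- limits of interior points.
  have hpc : (t₀, y) ∈ closure (interior S) := by
    rw [hS, interior_prod_eq, closure_prod_eq, interior_Icc, closure_Ioo hT.ne]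
    exact ⟨ht₀, hyc⟩
  have hFd : ∀ᶠ p in 𝓝[S] (t₀, y), DifferentiableWithinAt ℝ F S p := by
    have := (hF.of_le (m := 1) (by simp)).eventually (by simp)
    rw [insert_eq_of_mem hp] at this
    exact this.mono fun p hp => hp.differentiableWithinAt (by simp)
  have hslice1 : ContinuousWithinAt (fun t : ℝ => (t, y)) (Icc 0 T) t₀ := by fun_prop
  have hslice2 : ContinuousWithinAt (fun z : E => (t₀, z)) R y := by fun_prop
  have hm1 : MapsTo (fun t : ℝ => (t, y)) (Icc 0 T) S := fun t ht => ⟨ht, hy⟩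
  have hm2 : ∀ t ∈ Icc 0 T, MapsTo (fun z : E => (t, z)) R S := fun t ht z hz => ⟨ht, hz⟩
  -- the partial derivatives of `F`
  have hdy : ∀ t ∈ Icc 0 T, ∀ z ∈ R, DifferentiableWithinAt ℝ F S (t, z) →
      HasFDerivWithinAt (fun z => F (t, z))
        ((fderivWithin ℝ F S (t, z)).comp (ContinuousLinearMap.inr ℝ ℝ E)) R z := fun t ht z hz h =>
    h.hasFDerivWithinAt.comp z (hasFDerivAt_prodMk_right t z).hasFDerivWithinAt (hm2 t ht)
  have hdt : ∀ z ∈ R, DifferentiableWithinAt ℝ F S (t₀, z) →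
      HasDerivWithinAt (fun t => F (t, z)) (fderivWithin ℝ F S (t₀, z) (1, 0)) (Icc 0 T) t₀ :=
    fun z hz h => by
      have hm3 : MapsTo (fun t : ℝ => (t, z)) (Icc 0 T) S := fun t ht => ⟨ht, hz⟩
      have := h.hasFDerivWithinAt.comp t₀ (hasFDerivAt_prodMk_left t₀ z).hasFDerivWithinAt hm3
      simpa [Function.comp_def] using this.hasDerivWithinAt
  have hD2 : HasFDerivWithinAt (fderivWithin ℝ F S) (fderivWithin ℝ (fderivWithin ℝ F S) S (t₀, y))
      S (t₀, y) :=
    ((hF.fderivWithin_right (m := 1) hSu (by norm_cast) hp).differentiableWithinAt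
      (by simp)).hasFDerivWithinAt
  set D2 := fderivWithin ℝ (fderivWithin ℝ F S) S (t₀, y) with hD2def
  have hsymm : IsSymmSndFDerivWithinAt ℝ F S (t₀, y) :=
    hF.isSymmSndFDerivWithinAt (by simp; norm_cast) hSu hpc hp
  have hA' : HasDerivWithinAt (fun t => fderivWithin ℝ (fun z => F (t, z)) R y)
      ((D2 (1, 0)).comp (ContinuousLinearMap.inr ℝ ℝ E)) (Icc 0 T) t₀ := by
    have h1 := hD2.comp t₀ (hasFDerivAt_prodMk_left t₀ y).hasFDerivWithinAt hm1
    have h2 := h1.hasDerivWithinAt.clm_comp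
      (hasDerivWithinAt_const t₀ (Icc 0 T) (ContinuousLinearMap.inr ℝ ℝ E))
    have h3 : (fun t => fderivWithin ℝ (fun z => F (t, z)) R y) =ᶠ[𝓝[Icc 0 T] t₀]
        fun t => (fderivWithin ℝ F S (t, y)).comp (ContinuousLinearMap.inr ℝ ℝ E) := by
      have h4 := (hslice1.tendsto_nhdsWithin hm1).eventually hFd
      filter_upwards [h4, self_mem_nhdsWithin] with t ht ht'
      exact (hdy t ht' y hy ht).fderivWithin (hR y hy)
    refine HasDerivWithinAt.congr_of_eventuallyEq ?_ h3 (h3.eq_of_nhdsWithin ht₀)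
    simpa using h2
  -- The mixed derivatives commute, and ∂_t F(t₀, z) = v(F(t₀, z)) for z near y; the chain rule in z
  -- then gives the linearized equation.
  have hkey : ∀ e, D2 (1, 0) (0, e) = Dv (fderivWithin ℝ (fun z => F (t₀, z)) R y e) := by
    intro e
    rw [hsymm.eq]
    have h0 := hdy t₀ ht₀ y hy (hF.differentiableWithinAt (by simp))
    have h1 : HasFDerivWithinAt (fun z => fderivWithin ℝ F S (t₀, z) (1, 0)) _ R y :=
      (hD2.comp y (hasFDerivAt_prodMk_right t₀ y).hasFDerivWithinAt (hm2 t₀ ht₀)).clm_apply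
        (hasFDerivWithinAt_const (1, 0) y R)
    have h2 : HasFDerivWithinAt (fun z => v (F (t₀, z))) _ R y := hv.comp y h0 hm
    have h3 : (fun z => fderivWithin ℝ F S (t₀, z) (1, 0)) =ᶠ[𝓝[R] y] fun z => v (F (t₀, z)) := by
      have h4 := (hslice2.tendsto_nhdsWithin (hm2 t₀ ht₀)).eventually hFd
      filter_upwards [h4, hode, self_mem_nhdsWithin] with z hz hz' hzR
      exact (hIcc t₀ ht₀).eq_deriv _ (hdt z hzR hz) hz'
    have h5 := (hR y hy).eq h1 (h2.congr_of_eventuallyEq h3 (h3.eq_of_nhdsWithin hy))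
    have h6 := congrArg (fun L => L e) h5
    rw [h0.fderivWithin (hR y hy)]
    simpa using h6
  convert! hA' using 1
  ext e
  simpa using (hkey e).symm

/-! ### Conservation of mass along trajectories -/

namespace LagrangianHeat

variable {d : ℕ}
  {H : Type*} [TopologicalSpace H] {I : ModelWithCorners ℝ (EuclideanSpace ℝ (Fin d)) H}
  {M : Type*} [TopologicalSpace M] [ChartedSpace H M]
  {H' : Type*} [TopologicalSpace H'] {J : ModelWithCorners ℝ (EuclideanSpace ℝ (Fin d)) H'}
  {N : Type*} [TopologicalSpace N] [ChartedSpace H' N]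
  [IsManifold I ∞ M] [IsManifold J ∞ N]

/-- The derivative of the chart inverts the derivative of the inverse chart. Hence the coordinate
field in the definition of `divergence` is the velocity of the flow in coordinates. -/
theorem mpullbackWithin_extChartAt_symm_apply (q : N) (W : ∀ y : N, TangentSpace J y) {p : N}
    (hp : p ∈ (extChartAt J q).source) :
    (VectorField.mpullbackWithin 𝓘(ℝ, EuclideanSpace ℝ (Fin d)) J (extChartAt J q).symm W
      (range J) (extChartAt J q p) : EuclideanSpace ℝ (Fin d)) =
    (mfderiv J 𝓘(ℝ, EuclideanSpace ℝ (Fin d)) (extChartAt J q) p (W p) :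
      EuclideanSpace ℝ (Fin d)) := by
  have hw := (extChartAt J q).map_source hp
  rw [VectorField.mpullbackWithin_apply, ContinuousLinearMap.inverse_eq
    (mfderivWithin_extChartAt_symm_comp_mfderiv_extChartAt (I := J) hw)
    (mfderiv_extChartAt_comp_mfderivWithin_extChartAt_symm (I := J) hw)]
  exact congrArg (fun p => (mfderiv J 𝓘(ℝ, EuclideanSpace ℝ (Fin d)) (extChartAt J q) p (W p) :
    EuclideanSpace ℝ (Fin d))) ((extChartAt J q).left_inv hp)

variable {T : ℝ} {V : ℝ → ∀ y : N, TangentSpace J y} {ι : M → N} {Φ : ℝ → M → N}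

theorem IsFlowMap.contDiffWithinAt_chart (hΦ : IsFlowMap I J T V ι Φ) {t₀ : ℝ}
    (ht₀ : t₀ ∈ Icc 0 T) (x₀ : M) {y : EuclideanSpace ℝ (Fin d)}
    (hy : y ∈ (extChartAt I x₀).target) {q : N}
    (hq : Φ t₀ ((extChartAt I x₀).symm y) ∈ (extChartAt J q).source) :
    ContDiffWithinAt ℝ ∞ (fun p : ℝ × EuclideanSpace ℝ (Fin d) =>
      extChartAt J q (Φ p.1 ((extChartAt I x₀).symm p.2))) (Icc 0 T ×ˢ range I) (t₀, y) := by
  have h1 : ContMDiffWithinAt 𝓘(ℝ, ℝ × EuclideanSpace ℝ (Fin d)) (𝓘(ℝ, ℝ).prod I) ∞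
      (fun p : ℝ × EuclideanSpace ℝ (Fin d) => (p.1, (extChartAt I x₀).symm p.2))
      (Icc 0 T ×ˢ range I) (t₀, y) :=
    (contDiff_fst.contMDiff _).contMDiffWithinAt.prodMk
      ((contMDiffWithinAt_extChartAt_symm_range x₀ hy).comp (t₀, y)
        (contDiff_snd.contMDiff _).contMDiffWithinAt (fun p hp => hp.2))
  have hm : MapsTo (fun p : ℝ × EuclideanSpace ℝ (Fin d) => (p.1, (extChartAt I x₀).symm p.2))
      (Icc 0 T ×ˢ range I) (Icc 0 T ×ˢ univ) := fun p hp => ⟨hp.1, mem_univ _⟩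
  have h2 := (hΦ.smooth (t₀, (extChartAt I x₀).symm y) ⟨ht₀, mem_univ _⟩).comp (t₀, y) h1 hm
  have h3 : ContMDiffAt J 𝓘(ℝ, EuclideanSpace ℝ (Fin d)) ∞ (extChartAt J q)
      (Φ t₀ ((extChartAt I x₀).symm y)) :=
    contMDiffAt_extChartAt' (by rwa [extChartAt_source] at hq)
  exact (h3.comp_contMDiffWithinAt (t₀, y) h2).contDiffWithinAt

theorem IsFlowMap.hasDerivWithinAt_chart (hΦ : IsFlowMap I J T V ι Φ) {t₀ : ℝ}
    (ht₀ : t₀ ∈ Icc 0 T) (x : M) {q : N} (hq : Φ t₀ x ∈ (extChartAt J q).source) :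
    HasDerivWithinAt (fun t => extChartAt J q (Φ t x))
      (VectorField.mpullbackWithin 𝓘(ℝ, EuclideanSpace ℝ (Fin d)) J (extChartAt J q).symm (V t₀)
      (range J) (extChartAt J q (Φ t₀ x)) : EuclideanSpace ℝ (Fin d)) (Icc 0 T) t₀ := by
  rw [mpullbackWithin_extChartAt_symm_apply q (V t₀) hq]
  have hφ : HasMFDerivAt J 𝓘(ℝ, EuclideanSpace ℝ (Fin d)) (extChartAt J q) (Φ t₀ x) _ :=
    (mdifferentiableAt_extChartAt (by rwa [extChartAt_source] at hq)).hasMFDerivAt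
  let L : EuclideanSpace ℝ (Fin d) →L[ℝ] EuclideanSpace ℝ (Fin d) :=
    mfderiv J 𝓘(ℝ, EuclideanSpace ℝ (Fin d)) (extChartAt J q) (Φ t₀ x)
  let a : EuclideanSpace ℝ (Fin d) := V t₀ (Φ t₀ x)
  change HasDerivWithinAt _ (L a) _ _
  have h1 : HasFDerivWithinAt (fun t => extChartAt J q (Φ t x))
      ((1 : ℝ →L[ℝ] ℝ).smulRight (L a)) (Icc 0 T) t₀ := by
    have h2 : HasFDerivWithinAt (fun t => extChartAt J q (Φ t x))
        (L.comp ((1 : ℝ →L[ℝ] ℝ).smulRight a)) (Icc 0 T) t₀ :=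
      (hφ.comp_hasMFDerivWithinAt t₀ (hΦ.ode t₀ ht₀ x)).hasFDerivWithinAt
    have h3 : L.comp ((1 : ℝ →L[ℝ] ℝ).smulRight a) = (1 : ℝ →L[ℝ] ℝ).smulRight (L a) := by
      ext
      simp
    rwa [h3] at h2
  simpa only [ContinuousLinearMap.smulRight_apply, one_apply_eq_self, one_smul]
    using h1.hasDerivWithinAt

theorem IsSmoothTimeDepField.differentiableWithinAt_chart (hV : IsSmoothTimeDepField J T V) {t : ℝ}
    (ht : t ∈ Icc 0 T) (q : N) :
    DifferentiableWithinAt ℝ (VectorField.mpullbackWithin 𝓘(ℝ, EuclideanSpace ℝ (Fin d)) J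
      (extChartAt J q).symm (V t) (range J) : EuclideanSpace ℝ (Fin d) → EuclideanSpace ℝ (Fin d))
      (range J) (extChartAt J q q) := by
  have h1 : ContMDiffOn J J.tangent ∞ (fun y => (⟨y, V t y⟩ : TangentBundle J N)) univ :=
    ContMDiffOn.comp (t := Icc 0 T ×ˢ univ) (f := fun y : N => (t, y)) hV
      (contMDiff_const.prodMk contMDiff_id).contMDiffOn (fun y _ => ⟨ht, mem_univ _⟩)
  have h2 := VectorField.contMDiffWithinAt_mpullbackWithin_extChartAt_symm (m := 1) (n := ∞)
    ((h1 q (mem_univ q)).of_le (by simp)) uniqueMDiffOn_univ (mem_univ q) (by norm_cast)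
  have h3 := ((contMDiff_snd_tangentBundle_modelSpace (EuclideanSpace ℝ (Fin d))
    𝓘(ℝ, EuclideanSpace ℝ (Fin d)) (n := 1)).contMDiffAt.comp_contMDiffWithinAt _
      h2).contDiffWithinAt.differentiableWithinAt one_ne_zero
  refine h3.mono_of_mem_nhdsWithin ?_
  simpa using extChartAt_target_mem_nhdsWithin q

/-- The derivative along a trajectory is ∂_t ρ + dρ(V). The transport term cancels the one in the
continuity equation. -/
theorem IsMassDensity.hasDerivWithinAt_comp_flow (hT : 0 < T) {g : BilinField J N} {ρ : ℝ → N → ℝ}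
    (hρ : IsMassDensity J T g V ρ) (hΦ : IsFlowMap I J T V ι Φ) {t₀ : ℝ}
    (ht₀ : t₀ ∈ Icc 0 T) (x : M) :
    HasDerivWithinAt (fun t => ρ t (Φ t x))
      (-ρ t₀ (Φ t₀ x) * divergence J g (V t₀) (Φ t₀ x)) (Icc 0 T) t₀ := by
  set q := Φ t₀ x with hq
  set φ := extChartAt J q with hφ
  have hqs : q ∈ φ.source := mem_extChartAt_source q
  have hqt : φ q ∈ φ.target := mem_extChartAt_target q
  have hR : ContDiffWithinAt ℝ ∞ (fun p : ℝ × EuclideanSpace ℝ (Fin d) => ρ p.1 (φ.symm p.2))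
      (Icc 0 T ×ˢ range J) (t₀, φ q) := by
    have h1 : ContMDiffWithinAt 𝓘(ℝ, ℝ × EuclideanSpace ℝ (Fin d)) (𝓘(ℝ, ℝ).prod J) ∞
        (fun p : ℝ × EuclideanSpace ℝ (Fin d) => (p.1, φ.symm p.2))
        (Icc 0 T ×ˢ range J) (t₀, φ q) :=
      (contDiff_fst.contMDiff _).contMDiffWithinAt.prodMk
        ((contMDiffWithinAt_extChartAt_symm_range q hqt).comp (t₀, φ q)
          (contDiff_snd.contMDiff _).contMDiffWithinAt (fun p hp => hp.2))
    have hm : MapsTo (fun p : ℝ × EuclideanSpace ℝ (Fin d) => (p.1, φ.symm p.2))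
        (Icc 0 T ×ˢ range J) (Icc 0 T ×ˢ univ) := fun p hp => ⟨hp.1, mem_univ _⟩
    exact ((hρ.smooth (t₀, φ.symm (φ q)) ⟨ht₀, mem_univ _⟩).comp (t₀, φ q) h1
      hm).contDiffWithinAt
  have hDR := (hR.differentiableWithinAt (by simp)).hasFDerivWithinAt
  set DR := fderivWithin ℝ (fun p : ℝ × EuclideanSpace ℝ (Fin d) => ρ p.1 (φ.symm p.2))
      (Icc 0 T ×ˢ range J) (t₀, φ q)
  set w : EuclideanSpace ℝ (Fin d) := V t₀ q with hw
  have hc : HasDerivWithinAt (fun t => φ (Φ t x)) w (Icc 0 T) t₀ := by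
    have h1 := hΦ.hasDerivWithinAt_chart ht₀ x hqs
    rw [mpullbackWithin_extChartAt_symm_apply q (V t₀) hqs, mfderiv_extChartAt_self] at h1
    exact h1
  have h1 : HasDerivWithinAt (fun t => ρ t (φ.symm (φ (Φ t x)))) (DR (1, w)) (Icc 0 T) t₀ :=
    hDR.comp_hasDerivWithinAt (f := fun t => (t, φ (Φ t x))) t₀
      ((hasDerivWithinAt_id t₀ _).prodMk hc) (fun t ht => ⟨ht, mem_range_self _⟩)
  have h2 : DR (1, 0) = -(extDer J (ρ t₀) q (V t₀ q)) - ρ t₀ q * divergence J g (V t₀) q := by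
    have h3 : HasDerivWithinAt (fun t => ρ t (φ.symm (φ q))) (DR (1, 0)) (Icc 0 T) t₀ :=
      hDR.comp_hasDerivWithinAt (f := fun t => (t, φ q)) t₀
        ((hasDerivWithinAt_id t₀ _).prodMk (hasDerivWithinAt_const _ _ _))
        (fun t ht => ⟨ht, mem_range_self _⟩)
    rw [φ.left_inv hqs] at h3
    exact (uniqueDiffOn_Icc hT t₀ ht₀).eq_deriv _ h3 (hρ.continuity t₀ ht₀ q)
  have h3 : DR (0, w) = extDer J (ρ t₀) q (V t₀ q) := by
    have h4 : HasFDerivWithinAt (fun z => ρ t₀ (φ.symm z))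
        (DR.comp (ContinuousLinearMap.inr ℝ ℝ (EuclideanSpace ℝ (Fin d)))) (range J) (φ q) :=
      hDR.comp (φ q) (hasFDerivAt_prodMk_right t₀ (φ q)).hasFDerivWithinAt
        (fun z hz => ⟨ht₀, hz⟩ : MapsTo (fun z => (t₀, z)) (range J) (Icc 0 T ×ˢ range J))
    have h5 : MDifferentiableAt J 𝓘(ℝ, ℝ) (ρ t₀) q := by
      have h6 : ContMDiffOn J 𝓘(ℝ, ℝ) ∞ (ρ t₀) univ :=
        ContMDiffOn.comp (t := Icc 0 T ×ˢ univ) (f := fun y : N => (t₀, y)) hρ.smooth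
          (contMDiff_const.prodMk contMDiff_id).contMDiffOn (fun y _ => ⟨ht₀, mem_univ _⟩)
      exact (contMDiffOn_univ.1 h6 q).mdifferentiableAt (by simp)
    have h7 : mfderiv J 𝓘(ℝ, ℝ) (ρ t₀) q =
        DR.comp (ContinuousLinearMap.inr ℝ ℝ (EuclideanSpace ℝ (Fin d))) := by
      rw [h5.mfderiv]
      exact h4.fderivWithin (J.uniqueDiffOn _ (mem_range_self _))
    have h8 := congrArg (fun L : EuclideanSpace ℝ (Fin d) →L[ℝ] ℝ => L w) h7
    exact h8.symm
  have h4 : DR (1, w) = -ρ t₀ q * divergence J g (V t₀) q := by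
    have : ((1 : ℝ), w) = (1, 0) + (0, w) := by simp
    rw [this, map_add, h2, h3]
    ring
  rw [h4] at h1
  have hev : ∀ᶠ t in 𝓝[Icc 0 T] t₀, Φ t x ∈ φ.source :=
    (hΦ.ode t₀ ht₀ x).continuousWithinAt (extChartAt_source_mem_nhds q)
  refine h1.congr_of_eventuallyEq ?_ (by rw [φ.left_inv hqs])
  filter_upwards [hev] with t ht
  rw [φ.left_inv ht]

/-- The mass `ρ √det g(t)` per coordinate volume is carried along by the flow. -/
theorem hasDerivWithinAt_mass (hT : 0 < T)
    (g : Bundle.ContMDiffRiemannianMetric J ∞ (EuclideanSpace ℝ (Fin d))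
      (fun y : N => TangentSpace J y)) (hV : IsSmoothTimeDepField J T V)
    (hΦ : IsFlowMap I J T V ι Φ) {ρ : ℝ → N → ℝ} (hρ : IsMassDensity J T g.inner V ρ)
    (x₀ : M) {y : EuclideanSpace ℝ (Fin d)} (hy : y ∈ (extChartAt I x₀).target)
    {t₀ : ℝ} (ht₀ : t₀ ∈ Icc 0 T) :
    HasDerivWithinAt (fun t => ρ t (Φ t ((extChartAt I x₀).symm y)) *
      volDensity I (pullbackMetric I J (Φ t) g.inner) x₀ y) 0 (Icc 0 T) t₀ := by
  set x := (extChartAt I x₀).symm y with hx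
  set q := Φ t₀ x with hq
  set φ := extChartAt J q with hφ
  have hqs : q ∈ φ.source := mem_extChartAt_source q
  have hg := isSmoothMetric_inner g
  have hyR := extChartAt_target_subset_range x₀ hy
  set s := volDensity J g.inner q with hs
  set v : EuclideanSpace ℝ (Fin d) → EuclideanSpace ℝ (Fin d) :=
    VectorField.mpullbackWithin 𝓘(ℝ, EuclideanSpace ℝ (Fin d)) J φ.symm (V t₀) (range J) with hvdef
  have hs0 : 0 < s (φ q) := hg.volDensity_pos q (mem_extChartAt_target q)
  have hsd : HasFDerivWithinAt s (fderivWithin ℝ s (range J) (φ q)) (range J) (φ q) :=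
    (((hg.contDiffOn_volDensity q _ (mem_extChartAt_target q)).differentiableWithinAt
      (by simp)).mono_of_mem_nhdsWithin (extChartAt_target_mem_nhdsWithin q)).hasFDerivWithinAt
  have hvd : HasFDerivWithinAt v (fderivWithin ℝ v (range J) (φ q)) (range J) (φ q) :=
    (hV.differentiableWithinAt_chart ht₀ q).hasFDerivWithinAt
  have hF := hΦ.contDiffWithinAt_chart ht₀ x₀ hy hqs
  have hc : HasDerivWithinAt (fun t => φ (Φ t x)) (v (φ q)) (Icc 0 T) t₀ :=
    hΦ.hasDerivWithinAt_chart ht₀ x hqs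
  have hev : ∀ᶠ t in 𝓝[Icc 0 T] t₀, Φ t x ∈ φ.source :=
    (hΦ.ode t₀ ht₀ x).continuousWithinAt (extChartAt_source_mem_nhds q)
  have hA := hasDerivWithinAt_fderivWithin_flow hT ht₀ I.uniqueDiffOn hyR
    (I.range_subset_closure_interior hyR) hF hvd (fun z _ => mem_range_self _) (by
      have h1 : ContinuousWithinAt (fun z => Φ t₀ ((extChartAt I x₀).symm z)) (range I) y :=
        ((hΦ.embedded t₀ ht₀).smooth.continuous.continuousAt).comp_continuousWithinAt
          (contMDiffWithinAt_extChartAt_symm_range (n := ∞) x₀ hy).continuousWithinAt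
      filter_upwards [h1 (extChartAt_source_mem_nhds (I := J) q)] with z hz
      exact hΦ.hasDerivWithinAt_chart ht₀ _ hz)
  have hdet := ContinuousLinearMap.hasDerivWithinAt_det hA
  have hvol : ∀ t ∈ Icc 0 T, Φ t x ∈ φ.source →
      volDensity I (pullbackMetric I J (Φ t) g.inner) x₀ y =
      |(fderivWithin ℝ (fun z => φ (Φ t ((extChartAt I x₀).symm z))) (range I) y).det| *
        s (φ (Φ t x)) := fun t ht hts =>
    volDensity_pullbackMetric g.inner x₀ q hy
      ((hΦ.embedded t ht).smooth.mdifferentiableAt (by simp)) hts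
  -- A zero determinant would annihilate the volume density of the pulled back metric, which is
  -- positive. Thus the absolute value is differentiable at the determinant.
  have hdet0 : (fderivWithin ℝ (fun z => φ (Φ t₀ ((extChartAt I x₀).symm z))) (range I) y).det ≠ 0 := by
    intro h0
    have h1 := ((hΦ.embedded t₀ ht₀).isSmoothMetric_pullbackMetric g).volDensity_pos x₀ hy
    rw [hvol t₀ ht₀ hqs, h0] at h1
    simp at h1
  have habs := (hasDerivAt_abs hdet0).comp_hasDerivWithinAt t₀ hdet
  have hsc : HasDerivWithinAt (fun t => s (φ (Φ t x)))
      (fderivWithin ℝ s (range J) (φ q) (v (φ q))) (Icc 0 T) t₀ :=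
    hsd.comp_hasDerivWithinAt (f := fun t => φ (Φ t x)) t₀ hc (fun t _ => mem_range_self _)
  have hρd := hρ.hasDerivWithinAt_comp_flow hT hΦ ht₀ x
  -- The derivative of s v is s Dv + ds ⊗ v; the rank-one term has trace ds(v).
  have hdiv : s (φ q) * divergence J g.inner (V t₀) q =
      s (φ q) * LinearMap.trace ℝ (EuclideanSpace ℝ (Fin d)) (fderivWithin ℝ v (range J) (φ q)) +
        fderivWithin ℝ s (range J) (φ q) (v (φ q)) := by
    have h1 : fderivWithin ℝ (fun z => s z • v z) (range J) (φ q) = _ :=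
      (hsd.smul hvd).fderivWithin (J.uniqueDiffOn _ (mem_range_self _))
    have h2 : divergence J g.inner (V t₀) q = (s (φ q))⁻¹ *
      LinearMap.trace ℝ (EuclideanSpace ℝ (Fin d))
        (fderivWithin ℝ (fun z => s z • v z) (range J) (φ q)).toLinearMap := rfl
    rw [h2, h1, mul_inv_cancel_left₀ hs0.ne']
    rw [ContinuousLinearMap.toLinearMap_add, map_add, ContinuousLinearMap.toLinearMap_smul,
      map_smul, smul_eq_mul]
    congr 1
    exact LinearMap.trace_smulRight _ _
  have hmain := hρd.mul (habs.mul hsc)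
  have hev2 : (fun t => ρ t (Φ t x) * volDensity I (pullbackMetric I J (Φ t) g.inner) x₀ y)
      =ᶠ[𝓝[Icc 0 T] t₀] fun t => ρ t (Φ t x) *
      (|(fderivWithin ℝ (fun z => φ (Φ t ((extChartAt I x₀).symm z))) (range I) y).det| *
        s (φ (Φ t x))) := by
    filter_upwards [hev, self_mem_nhdsWithin] with t ht ht'
    rw [hvol t ht' ht]
  refine (hmain.congr_of_eventuallyEq hev2 (hev2.eq_of_nhdsWithin ht₀)).congr_deriv ?_
  simp only [Function.comp_apply, Pi.mul_apply]
  -- With |D| = D sign D for the Jacobian determinant D, the claim is −ρ|D| times `hdiv`.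
  rw [← self_mul_sign]
  linear_combination -ρ t₀ q * SignType.sign (fderivWithin ℝ
    (fun z => φ (Φ t₀ ((extChartAt I x₀).symm z))) (range I) y).det *
    (fderivWithin ℝ (fun z => φ (Φ t₀ ((extChartAt I x₀).symm z))) (range I) y).det * hdiv

theorem mass_eq (hT : 0 < T)
    (g : Bundle.ContMDiffRiemannianMetric J ∞ (EuclideanSpace ℝ (Fin d))
      (fun y : N => TangentSpace J y)) (hV : IsSmoothTimeDepField J T V)
    (hΦ : IsFlowMap I J T V ι Φ) {ρ : ℝ → N → ℝ} (hρ : IsMassDensity J T g.inner V ρ)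
    (x₀ : M) {y : EuclideanSpace ℝ (Fin d)} (hy : y ∈ (extChartAt I x₀).target)
    {t : ℝ} (ht : t ∈ Icc 0 T) :
    ρ t (Φ t ((extChartAt I x₀).symm y)) *
      volDensity I (pullbackMetric I J (Φ t) g.inner) x₀ y =
    ρ 0 (ι ((extChartAt I x₀).symm y)) * volDensity I (pullbackMetric I J ι g.inner) x₀ y := by
  have h := fun t ht => hasDerivWithinAt_mass hT g hV hΦ hρ x₀ hy (t₀ := t) ht
  have h1 := constant_of_derivWithin_zero (fun t ht => (h t ht).differentiableWithinAt)
    (fun t ht => (h t (Ico_subset_Icc_self ht)).derivWithin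
      (uniqueDiffOn_Icc hT t (Ico_subset_Icc_self ht))) t ht
  simpa only [hΦ.initial] using h1

end LagrangianHeat

/-! ### The transported mass measure -/

theorem MeasureTheory.Measure.withDensity_map {X Y : Type*} [MeasurableSpace X]
    [MeasurableSpace Y] {m : Measure X} {f : X → Y} (hf : AEMeasurable f m) {k : Y → ENNReal}
    (hk : Measurable k) : (m.map f).withDensity k = (m.withDensity (k ∘ f)).map f := by
  refine Measure.ext_of_lintegral _ fun φ hφ => ?_
  rw [lintegral_withDensity_eq_lintegral_mul _ hk hφ,
    lintegral_map' (hk.mul hφ).aemeasurable hf,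
    lintegral_map' hφ.aemeasurable (hf.mono_ac (withDensity_absolutelyContinuous _ _)),
    lintegral_withDensity_eq_lintegral_mul₀ (f := k ∘ f) (g := fun x => φ (f x))
      (hk.comp_aemeasurable hf) (hφ.comp_aemeasurable hf)]
  rfl

namespace LagrangianHeat

variable {d : ℕ}
  {H : Type*} [TopologicalSpace H] {I : ModelWithCorners ℝ (EuclideanSpace ℝ (Fin d)) H}
  {M : Type*} [TopologicalSpace M] [ChartedSpace H M]
  {H' : Type*} [TopologicalSpace H'] {J : ModelWithCorners ℝ (EuclideanSpace ℝ (Fin d)) H'}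
  {N : Type*} [TopologicalSpace N] [ChartedSpace H' N]
  [IsManifold I ∞ M] [IsManifold J ∞ N] [MeasurableSpace M] [BorelSpace M]

/-- The measure `r dω_h`. -/
noncomputable def densityMeasure (h : BilinField I M) (r : M → ℝ) : Measure M :=
  (riemVolume I h).withDensity fun x => ENNReal.ofReal (r x)

theorem aemeasurable_extChartAt_symm (x₀ : M) :
    AEMeasurable (extChartAt I x₀).symm
      ((volume : Measure (EuclideanSpace ℝ (Fin d))).restrict (extChartAt I x₀).target) :=
  (continuousOn_extChartAt_symm x₀).aemeasurable (measurableSet_extChartAt_target x₀)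

/-- Through this formula all comparisons of measures and all integrals on `M` are reduced to
Lebesgue measure. -/
theorem densityMeasure_restrict_source {h : BilinField I M} (hh : IsSmoothMetric I h) {r : M → ℝ}
    (hr : Continuous r) (x₀ : M) :
    (densityMeasure h r).restrict (extChartAt I x₀).source =
      (((volume : Measure (EuclideanSpace ℝ (Fin d))).restrict
        (extChartAt I x₀).target).withDensity fun y =>
          ENNReal.ofReal (volDensity I h x₀ y * r ((extChartAt I x₀).symm y))).map
        (extChartAt I x₀).symm := by
  have hT := measurableSet_extChartAt_target (I := I) x₀
  have hσ : AEMeasurable (fun y => ENNReal.ofReal (volDensity I h x₀ y))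
      ((volume : Measure (EuclideanSpace ℝ (Fin d))).restrict (extChartAt I x₀).target) :=
    ((hh.contDiffOn_volDensity x₀).continuousOn.aemeasurable hT).ennreal_ofReal
  have hk : Measurable fun x => ENNReal.ofReal (r x) := hr.measurable.ennreal_ofReal
  rw [densityMeasure, restrict_withDensity (isOpen_extChartAt_source x₀).measurableSet,
    riemVolume_restrict_source, chartVolume, Measure.withDensity_map
      ((aemeasurable_extChartAt_symm x₀).mono_ac (withDensity_absolutelyContinuous _ _)) hk,
    ← withDensity_mul₀ hσ (hk.comp_aemeasurable (aemeasurable_extChartAt_symm x₀))]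
  congr 1
  refine withDensity_congr_ae ?_
  filter_upwards [ae_restrict_mem hT] with y hy
  rw [ENNReal.ofReal_mul (hh.volDensity_pos x₀ hy).le]
  rfl

theorem measure_ext_of_restrict_source [CompactSpace M] {μ ν : Measure M}
    (h : ∀ x₀ : M, μ.restrict (extChartAt I x₀).source = ν.restrict (extChartAt I x₀).source) :
    μ = ν := by
  obtain ⟨s, -, hs⟩ := isCompact_univ.elim_nhds_subcover (fun x : M => (extChartAt I x).source)
    fun x _ => extChartAt_source_mem_nhds x
  rw [← Measure.restrict_univ (μ := μ), ← Measure.restrict_univ (μ := ν),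
    ← univ_subset_iff.1 hs]
  exact (Measure.restrict_biUnion_congr s.countable_toSet).2 fun x _ => h x

theorem continuous_density {T : ℝ} {V : ℝ → ∀ y : N, TangentSpace J y} {ι : M → N}
    {Φ : ℝ → M → N} {g : BilinField J N} {ρ : ℝ → N → ℝ}
    (hρ : IsMassDensity J T g V ρ) (hΦ : IsFlowMap I J T V ι Φ) {t : ℝ} (ht : t ∈ Icc 0 T) :
    Continuous fun x => ρ t (Φ t x) := by
  have h6 : ContMDiffOn J 𝓘(ℝ, ℝ) ∞ (ρ t) univ :=
    ContMDiffOn.comp (t := Icc 0 T ×ˢ univ) (f := fun y : N => (t, y)) hρ.smooth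
      (contMDiff_const.prodMk contMDiff_id).contMDiffOn (fun y _ => ⟨ht, mem_univ _⟩)
  exact (contMDiffOn_univ.1 h6).continuous.comp (hΦ.embedded t ht).smooth.continuous

section Flow

variable {T : ℝ} (hT : 0 < T) (g : Bundle.ContMDiffRiemannianMetric J ∞ (EuclideanSpace ℝ (Fin d))
      (fun y : N => TangentSpace J y)) {V : ℝ → ∀ y : N, TangentSpace J y}
    (hV : IsSmoothTimeDepField J T V) {ι : M → N} {Φ : ℝ → M → N}
    (hΦ : IsFlowMap I J T V ι Φ) {ρ : ℝ → N → ℝ} (hρ : IsMassDensity J T g.inner V ρ)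
    {t : ℝ} (ht : t ∈ Icc 0 T)

/-- The product of ρ and the volume density is constant in time and positive at time 0, and its
second factor is positive at every time. -/
theorem density_pos (hT : 0 < T) (hV : IsSmoothTimeDepField J T V)
    (hΦ : IsFlowMap I J T V ι Φ) (hρ : IsMassDensity J T g.inner V ρ) (ht : t ∈ Icc 0 T)
    (x : M) : 0 < ρ t (Φ t x) := by
  have h := mass_eq hT g hV hΦ hρ x (mem_extChartAt_target x) ht
  have h0 : (0 : ℝ) ∈ Icc 0 T := ⟨le_rfl, hT.le⟩
  have h1 := ((hΦ.embedded t ht).isSmoothMetric_pullbackMetric g).volDensity_pos x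
    (mem_extChartAt_target x)
  have h2 := ((hΦ.embedded 0 h0).isSmoothMetric_pullbackMetric g).volDensity_pos x
    (mem_extChartAt_target x)
  rw [hΦ.initial] at h2
  rw [extChartAt_to_inv] at h
  exact pos_of_mul_pos_left (h ▸ mul_pos (hρ.pos_initial _) h2) h1.le

theorem massMeasure_eq [CompactSpace M] (hT : 0 < T) (hV : IsSmoothTimeDepField J T V)
    (hΦ : IsFlowMap I J T V ι Φ) (hρ : IsMassDensity J T g.inner V ρ) (ht : t ∈ Icc 0 T) :
    massMeasure I J g.inner (Φ t) (ρ t) = massMeasure I J g.inner ι (ρ 0) := by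
  have h0 : (0 : ℝ) ∈ Icc 0 T := ⟨le_rfl, hT.le⟩
  refine measure_ext_of_restrict_source (I := I) fun x₀ => ?_
  have h1 := densityMeasure_restrict_source
    ((hΦ.embedded t ht).isSmoothMetric_pullbackMetric g) (continuous_density hρ hΦ ht) x₀
  have h2 := densityMeasure_restrict_source
    ((hΦ.embedded 0 h0).isSmoothMetric_pullbackMetric g) (continuous_density hρ hΦ h0) x₀
  rw [hΦ.initial] at h2
  refine h1.trans (Eq.trans ?_ h2.symm)
  congr 1
  refine withDensity_congr_ae ?_
  filter_upwards [ae_restrict_mem (measurableSet_extChartAt_target x₀)] with y hy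
  rw [mul_comm, mass_eq hT g hV hΦ hρ x₀ hy ht, mul_comm]

end Flow

theorem isFiniteMeasure_densityMeasure [CompactSpace M] {h : BilinField I M}
    (hh : IsSmoothMetric I h) {r : M → ℝ} (hr : Continuous r) :
    IsFiniteMeasure (densityMeasure h r) := by
  have := hh.isLocallyFiniteMeasure_riemVolume
  obtain ⟨C, hC⟩ := isCompact_univ.exists_bound_of_continuousOn hr.continuousOn
  exact isFiniteMeasure_withDensity_ofReal
    (HasFiniteIntegral.of_bounded (C := C) (ae_of_all _ fun x => hC x (mem_univ x)))

end LagrangianHeat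

/-! ### Linear algebra of Parseval frames -/

section Parseval

variable {E : Type*} [NormedAddCommGroup E] [NormedSpace ℝ E]

/-- One step of the Gram-Schmidt process, in which zero vectors are allowed. -/
theorem gramSchmidt_step {n : ℕ} (h : E →L[ℝ] E →L[ℝ] ℝ) (symm : ∀ u v, h u v = h v u)
    (pos : ∀ v, v ≠ 0 → 0 < h v v) (e : Fin n → E) (horth : ∀ i j, i ≠ j → h (e i) (e j) = 0)
    (hnorm : ∀ i, e i = 0 ∨ h (e i) (e i) = 1) (v : E) :
    let y := v - ∑ i, h (e i) v • e i
    let z := (√(h y y))⁻¹ • y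
    (∀ i, h (e i) z = 0) ∧ (z = 0 ∨ h z z = 1) ∧ v = h z v • z + ∑ i, h (e i) v • e i := by
  intro y z
  have h1 : ∀ i, h (e i) y = 0 := by
    intro i
    simp only [y, map_sub, map_sum, map_smul, smul_eq_mul]
    rw [Finset.sum_eq_single i (fun j _ hj => by rw [horth i j hj.symm, mul_zero]) (by simp)]
    rcases hnorm i with h0 | h0
    · simp [h0]
    · rw [h0, mul_one, sub_self]
  have h2 : ∀ i, h (e i) z = 0 := fun i => by simp [z, h1]
  have hvy : v = y + ∑ i, h (e i) v • e i := by simp [y]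
  by_cases hy : y = 0
  · have hz : z = 0 := by simp [z, hy]
    refine ⟨h2, Or.inl hz, ?_⟩
    conv_lhs => rw [hvy, hy]
    simp [hz]
  · have hp := pos y hy
    have hs : √(h y y) ≠ 0 := (Real.sqrt_pos.2 hp).ne'
    have hzz : h z z = 1 := by
      simp only [z, map_smul, smul_apply, smul_eq_mul]
      field_simp
      rw [Real.sq_sqrt hp.le]
    refine ⟨h2, Or.inr hzz, ?_⟩
    have hzv : h z v = √(h y y) := by
      conv_lhs => rw [hvy]
      have : ∀ i, h z (e i) = 0 := fun i => by rw [symm, h2]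
      simp only [map_add, map_sum, map_smul, this, smul_zero, Finset.sum_const_zero, add_zero]
      simp only [z, map_smul, smul_apply, smul_eq_mul]
      field_simp
      rw [Real.sq_sqrt hp.le]
    rw [hzv]
    simp only [z, smul_smul, mul_inv_cancel₀ hs, one_smul]
    exact hvy

/-- The inverse of a bilinear form with a Parseval frame. -/
theorem inverse_apply_of_parseval {n : ℕ} (h : E →L[ℝ] E →L[ℝ] ℝ) (symm : ∀ u v, h u v = h v u)
    (e : Fin n → E) (hpar : ∀ v, v = ∑ j, h (e j) v • e j) (β : E →L[ℝ] ℝ) :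
    h.inverse β = ∑ j, β (e j) • e j := by
  let G : (E →L[ℝ] ℝ) →L[ℝ] E := ∑ j, (ContinuousLinearMap.apply ℝ ℝ (e j)).smulRight (e j)
  have hG : ∀ β, G β = ∑ j, β (e j) • e j := fun β => by simp [G, sum_apply]
  rw [← hG]
  refine congrArg (fun L => L β) (ContinuousLinearMap.inverse_eq (g := G) ?_ ?_)
  · refine ContinuousLinearMap.ext fun γ => ContinuousLinearMap.ext fun u => ?_
    rw [ContinuousLinearMap.comp_apply, hG]
    conv_rhs => rw [hpar u]
    simp [sum_apply, mul_comm]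
  · refine ContinuousLinearMap.ext fun u => ?_
    rw [ContinuousLinearMap.comp_apply, hG]
    conv_rhs => rw [hpar u]
    simp [symm u]

/-- The projection onto the coordinate vectors of covectors is a contraction. -/
theorem sum_sq_frame_proj_le {n : ℕ} (h : E →L[ℝ] E →L[ℝ] ℝ) (symm : ∀ u v, h u v = h v u)
    (e : Fin n → E) (hpar : ∀ v, v = ∑ j, h (e j) v • e j) (k : Fin n → ℝ) :
    ∑ j, (∑ l, k l • h (e l)) (e j) ^ 2 ≤ ∑ j, k j ^ 2 := by
  set c : Fin n → ℝ := fun j => (∑ l, k l • h (e l)) (e j) with hc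
  have hcj : ∀ j, c j = h (e j) (∑ l, k l • e l) := fun j => by
    simp [hc, sum_apply, symm (e j)]
  have h1 : ∑ j, c j • e j = ∑ l, k l • e l := by
    simp only [hcj]
    exact (hpar _).symm
  have h2 : ∑ j, c j ^ 2 = ∑ j, k j * c j := by
    have h5 : ∀ (a : Fin n → ℝ) (w : E), ∑ j, a j * h (e j) w = h (∑ j, a j • e j) w :=
      fun a w => by simp [sum_apply]
    have h6 : ∑ j, c j ^ 2 = ∑ j, c j * h (e j) (∑ l, k l • e l) :=
      Finset.sum_congr rfl fun j _ => by rw [← hcj, sq]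
    rw [h6, h5, h1]
    simp only [hcj]
    rw [h5]
  -- The vector c is the orthogonal projection of k, so |c|² = ⟨k, c⟩ by `h2`; expanding |c − k|² ≥
  -- 0 gives the bound.
  have h3 : 0 ≤ ∑ j, (c j - k j) ^ 2 := Finset.sum_nonneg fun _ _ => sq_nonneg _
  have h4 : ∑ j, (c j - k j) ^ 2 = ∑ j, c j ^ 2 - 2 * ∑ j, k j * c j + ∑ j, k j ^ 2 := by
    rw [Finset.mul_sum, ← Finset.sum_sub_distrib, ← Finset.sum_add_distrib]
    exact Finset.sum_congr rfl fun _ _ => by ring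
  linarith

end Parseval

/-! ### Measurable frames on the manifold -/

namespace LagrangianHeat

variable {d : ℕ}
  {H : Type*} [TopologicalSpace H] {I : ModelWithCorners ℝ (EuclideanSpace ℝ (Fin d)) H}
  {M : Type*} [TopologicalSpace M] [ChartedSpace H M]
  [IsManifold I ∞ M] [MeasurableSpace M] [BorelSpace M]

/-- One-forms whose values on smooth vector fields are measurable. -/
def IsMeasurableForm (μ : Measure M) (α : OneForm I M) : Prop :=
  ∀ X : ∀ x : M, TangentSpace I x,
    ContMDiff I I.tangent ∞ (fun x => (⟨x, X x⟩ : TangentBundle I M)) →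
      AEMeasurable (fun x => α x (X x)) μ

/-- Vector fields on which measurable one-forms have measurable values. -/
def IsMeasurableField (μ : Measure M) (Y : ∀ x : M, TangentSpace I x) : Prop :=
  ∀ α : OneForm I M, IsMeasurableForm μ α → AEMeasurable (fun x => α x (Y x)) μ

variable {μ : Measure M}

theorem isMeasurableField_of_contMDiff {X : ∀ x : M, TangentSpace I x}
    (hX : ContMDiff I I.tangent ∞ (fun x => (⟨x, X x⟩ : TangentBundle I M))) :
    IsMeasurableField μ X := fun _ hα => hα X hX

theorem IsMeasurableField.smul {Y : ∀ x : M, TangentSpace I x} (hY : IsMeasurableField μ Y)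
    {c : M → ℝ} (hc : AEMeasurable c μ) : IsMeasurableField μ (fun x => c x • Y x) := fun α hα => by
  simp only [map_smul, smul_eq_mul]
  exact hc.mul (hY α hα)

theorem IsMeasurableField.sub {Y Z : ∀ x : M, TangentSpace I x} (hY : IsMeasurableField μ Y)
    (hZ : IsMeasurableField μ Z) : IsMeasurableField μ (fun x => Y x - Z x) := fun α hα => by
  simp only [map_sub]
  exact (hY α hα).sub (hZ α hα)

theorem IsMeasurableField.sum {n : ℕ} {Y : Fin n → ∀ x : M, TangentSpace I x}
    (hY : ∀ i, IsMeasurableField μ (Y i)) : IsMeasurableField μ (fun x => ∑ i, Y i x) :=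
  fun α hα => by
    simpa only [map_sum] using Finset.aemeasurable_fun_sum _ fun i _ => hY i α hα

/-- By symmetry h(Y, ·) at a smooth field X equals h(X, ·) at Y. The form h(X, ·) is measurable
because the metric is smooth, so measurability of Y applies to it. -/
theorem IsSmoothMetric.isMeasurableForm_flat {h : BilinField I M} (hh : IsSmoothMetric I h)
    {Y : ∀ x : M, TangentSpace I x} (hY : IsMeasurableField μ Y) :
    IsMeasurableForm μ (fun x => h x (Y x)) := by
  intro X hX
  have h1 : IsMeasurableForm μ (fun x => h x (X x)) := fun Z hZ =>
    (contMDiffOn_univ.1 (hh.smooth univ X Z hX.contMDiffOn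
      hZ.contMDiffOn)).continuous.measurable.aemeasurable
  simpa only [hh.symm _ (X _)] using hY _ h1

theorem IsSmoothMetric.aemeasurable_inner {h : BilinField I M} (hh : IsSmoothMetric I h)
    {Y Z : ∀ x : M, TangentSpace I x} (hY : IsMeasurableField μ Y) (hZ : IsMeasurableField μ Z) :
    AEMeasurable (fun x => h x (Y x) (Z x)) μ := hZ _ (hh.isMeasurableForm_flat hY)

theorem contMDiffOn_extDer_apply {w : M → ℝ} (hw : ContMDiff I 𝓘(ℝ, ℝ) ∞ w) {s : Set M}
    {X : ∀ x : M, TangentSpace I x}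
    (hX : ContMDiffOn I I.tangent ∞ (fun x => (⟨x, X x⟩ : TangentBundle I M)) s) :
    ContMDiffOn I 𝓘(ℝ, ℝ) ∞ (fun x => extDer I w x (X x)) s := by
  have h1 : ContMDiffOn I 𝓘(ℝ, ℝ).tangent ∞
      (fun x => tangentMap I 𝓘(ℝ, ℝ) w ⟨x, X x⟩) s :=
    (hw.contMDiff_tangentMap (m := ∞) le_rfl).comp_contMDiffOn hX
  exact (contMDiff_snd_tangentBundle_modelSpace ℝ 𝓘(ℝ, ℝ)).comp_contMDiffOn h1

theorem contMDiff_extDer_apply {w : M → ℝ} (hw : ContMDiff I 𝓘(ℝ, ℝ) ∞ w)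
    {X : ∀ x : M, TangentSpace I x}
    (hX : ContMDiff I I.tangent ∞ (fun x => (⟨x, X x⟩ : TangentBundle I M))) :
    ContMDiff I 𝓘(ℝ, ℝ) ∞ (fun x => extDer I w x (X x)) :=
  contMDiffOn_univ.1 (contMDiffOn_extDer_apply hw hX.contMDiffOn)

theorem isMeasurableForm_extDer {w : M → ℝ} (hw : ContMDiff I 𝓘(ℝ, ℝ) ∞ w) :
    IsMeasurableForm μ (extDer I w) := fun _ hX =>
  (contMDiff_extDer_apply hw hX).continuous.measurable.aemeasurable

/-- Measurable Gram-Schmidt orthonormalization of vector fields. -/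
theorem IsSmoothMetric.exists_gramSchmidt {h : BilinField I M} (hh : IsSmoothMetric I h) {n : ℕ}
    (X : Fin n → ∀ x : M, TangentSpace I x) (hX : ∀ i, IsMeasurableField μ (X i)) :
    ∃ E : Fin n → ∀ x : M, TangentSpace I x, (∀ i, IsMeasurableField μ (E i)) ∧
      ∀ x, (∀ i j, i ≠ j → h x (E i x) (E j x) = 0) ∧
        (∀ i, E i x = 0 ∨ h x (E i x) (E i x) = 1) ∧
        ∀ k, X k x = ∑ j, h x (E j x) (X k x) • E j x := by
  induction n with
  | zero => exact ⟨X, hX, fun x => ⟨fun i => i.elim0, fun i => i.elim0, fun i => i.elim0⟩⟩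
  | succ n ih =>
    obtain ⟨E, hE, hEx⟩ := ih (fun i => X i.succ) fun i => hX i.succ
    let Y : ∀ x : M, TangentSpace I x := fun x => X 0 x - ∑ i, h x (E i x) (X 0 x) • E i x
    let Z : ∀ x : M, TangentSpace I x := fun x => (√(h x (Y x) (Y x)))⁻¹ • Y x
    have hY : IsMeasurableField μ Y :=
      (hX 0).sub (IsMeasurableField.sum fun i => (hE i).smul (hh.aemeasurable_inner (hE i) (hX 0)))
    have hZ : IsMeasurableField μ Z :=
      hY.smul (hh.aemeasurable_inner hY hY).sqrt.inv
    refine ⟨Fin.cons Z E, Fin.cases hZ hE, fun x => ?_⟩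
    obtain ⟨horth, hnorm, hpar⟩ := hEx x
    obtain ⟨h1, h2, h3⟩ := gramSchmidt_step (E := EuclideanSpace ℝ (Fin d)) (h x) (hh.symm x)
      (hh.pos x) (fun i => E i x) horth hnorm (X 0 x)
    have h1' : ∀ i, h x (E i x) (Z x) = 0 := h1
    have h1'' : ∀ i, h x (Z x) (E i x) = 0 := fun i => by rw [hh.symm, h1']
    refine ⟨?_, ?_, ?_⟩
    · refine Fin.cases (Fin.cases (fun h => (h rfl).elim) fun j _ => h1'' j) fun i =>
        Fin.cases (fun _ => h1' i) fun j hij => horth i j fun h => hij (by rw [h])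
    · exact Fin.cases h2 hnorm
    · refine Fin.cases ?_ fun k => ?_
      · rw [Fin.sum_univ_succ]
        exact h3
      -- The old vectors are combinations of the E_i, to which Z is orthogonal, so their expansion
      -- gains no new term.
      · have h4 : h x (Z x) (X k.succ x) = 0 := by
          rw [hpar k]
          simp [h1'']
        rw [Fin.sum_univ_succ]
        simp only [Fin.cons_zero, Fin.cons_succ, h4, zero_smul, zero_add]
        exact hpar k

variable (I) in
/-- A smooth cut-off function around `p`. -/
noncomputable def cutoff (p : M) : SmoothBumpFunction I p :=
  Classical.arbitrary _

/-- The coordinate fields of the chart around `p`, cut off to smooth vector fields on `M`. -/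
noncomputable def cutField (p : M) (i : Fin d) (x : M) : TangentSpace I x :=
  cutoff I p x • coordField I p i x

theorem contMDiff_cutField [T2Space M] (p : M) (i : Fin d) :
    ContMDiff I I.tangent ∞ (fun x => (⟨x, cutField p i x⟩ : TangentBundle I M)) :=
  ContMDiffOn.smul_section_of_tsupport (cutoff I p).contMDiff.contMDiffOn
    (isOpen_extChartAt_source p) (cutoff I p).tsupport_subset_extChartAt_source
    (contMDiffOn_coordField p i)

/-- A measurable Parseval frame: measurable vector fields `E_j` with `h⁻¹ = ∑ E_j ⊗ E_j`. -/
theorem IsSmoothMetric.exists_frame [T2Space M] [CompactSpace M] {h : BilinField I M}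
    (hh : IsSmoothMetric I h) (μ : Measure M) :
    ∃ (n : ℕ) (E : Fin n → ∀ x : M, TangentSpace I x), (∀ i, IsMeasurableField μ (E i)) ∧
      ∀ (x : M) (v : TangentSpace I x), v = ∑ j, h x (E j x) v • E j x := by
  -- Where a cut-off equals 1, the cut-off coordinate fields span the tangent space. Finitely many
  -- such sets cover `M`, so a finite list of global smooth fields spans every tangent space. It may
  -- have more than d members, which is why Gram-Schmidt must allow zero vectors.
  obtain ⟨s, -, hs⟩ := isCompact_univ.elim_nhds_subcover
    (fun p : M => {x | x ∈ (extChartAt I p).source ∧ cutoff I p x = 1})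
    fun p _ => by
      filter_upwards [extChartAt_source_mem_nhds (I := I) p, (cutoff I p).eventuallyEq_one] with x h1 h2
      exact ⟨h1, h2⟩
  let F : s × Fin d → ∀ x : M, TangentSpace I x := fun q => cutField q.1.1 q.2
  let e := (Fintype.equivFin (s × Fin d)).symm
  obtain ⟨E, hE, hEx⟩ := hh.exists_gramSchmidt (μ := μ)
    (fun k => F (e k))
    fun k => isMeasurableField_of_contMDiff (contMDiff_cutField _ _)
  refine ⟨_, E, hE, fun x v => ?_⟩
  obtain ⟨p, hp, hxp, hx1⟩ : ∃ p ∈ s, x ∈ (extChartAt I p).source ∧ cutoff I p x = 1 := by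
    simpa only [mem_iUnion, exists_prop, mem_ofPred_eq] using hs (mem_univ x)
  obtain ⟨c, hc⟩ := exists_eq_sum_coordField p hxp v
  have h1 : ∀ i, coordField I p i x = ∑ j, h x (E j x) (coordField I p i x) • E j x := by
    intro i
    have h2 := (hEx x).2.2 (e.symm (⟨p, hp⟩, i))
    simp only [Equiv.apply_symm_apply] at h2
    simpa [F, cutField, hx1] using h2
  rw [hc]
  simp only [map_sum, map_smul, Finset.sum_smul]
  rw [Finset.sum_comm]
  refine Finset.sum_congr rfl fun i _ => ?_
  conv_lhs => rw [h1 i]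
  rw [Finset.smul_sum]
  exact Finset.sum_congr rfl fun j _ => by rw [smul_smul, smul_eq_mul]

end LagrangianHeat

/-! ### Square-integrable one-forms as vector-valued L² functions -/

namespace LagrangianHeat

variable {d : ℕ}
  {H : Type*} [TopologicalSpace H] {I : ModelWithCorners ℝ (EuclideanSpace ℝ (Fin d)) H}
  {M : Type*} [TopologicalSpace M] [ChartedSpace H M]
  [IsManifold I ∞ M] [MeasurableSpace M] [BorelSpace M]

/-- The components of a one-form in a frame. -/
noncomputable def frameCoord {n : ℕ} (E : Fin n → ∀ x : M, TangentSpace I x) (α : OneForm I M) (x : M) :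
    EuclideanSpace ℝ (Fin n) := WithLp.toLp 2 fun j => α x (E j x)

/-- The one-form `∑ k_j h(E_j, ·)`. -/
noncomputable def frameForm {n : ℕ} (h : BilinField I M) (E : Fin n → ∀ x : M, TangentSpace I x)
    (k : M → EuclideanSpace ℝ (Fin n)) : OneForm I M :=
  fun x => ∑ j, k x j • h x (E j x)

/-- A Parseval frame of the metric `h`. -/
def IsParseval {n : ℕ} (h : BilinField I M) (E : Fin n → ∀ x : M, TangentSpace I x) : Prop :=
  ∀ (x : M) (v : TangentSpace I x), v = ∑ j, h x (E j x) v • E j x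

variable {n : ℕ} {h : BilinField I M} {E : Fin n → ∀ x : M, TangentSpace I x} {μ : Measure M}

/-- A Parseval frame inverts the metric explicitly: the vector dual to β is ∑ β(E_j) E_j. -/
theorem dualMetric_eq_sum (hh : IsSmoothMetric I h) (hE : IsParseval h E) (x : M)
    (α β : TangentSpace I x →L[ℝ] ℝ) :
    dualMetric I h x α β = ∑ j, α (E j x) * β (E j x) := by
  have h1 : (h x).inverse β = ∑ j, β (E j x) • E j x :=
    inverse_apply_of_parseval (E := EuclideanSpace ℝ (Fin d)) (h x) (hh.symm x)
      (fun j => E j x) (hE x) β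
  rw [dualMetric, h1, map_sum]
  exact Finset.sum_congr rfl fun j _ => by rw [map_smul, smul_eq_mul, mul_comm]

theorem inner_frameCoord (hh : IsSmoothMetric I h) (hE : IsParseval h E) (α β : OneForm I M)
    (x : M) : ⟪frameCoord E α x, frameCoord E β x⟫_ℝ = dualMetric I h x (α x) (β x) := by
  rw [dualMetric_eq_sum hh hE, PiLp.inner_apply]
  exact Finset.sum_congr rfl fun j _ => mul_comm _ _

/-- The field `k` need not consist of the components of a one-form. The inner product sees only its
projection onto such components, and `frameForm` keeps exactly this projection. -/
theorem inner_frameCoord_left (hh : IsSmoothMetric I h) (hE : IsParseval h E) (α : OneForm I M)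
    (k : M → EuclideanSpace ℝ (Fin n)) (x : M) :
    ⟪frameCoord E α x, k x⟫_ℝ = dualMetric I h x (α x) (frameForm h E k x) := by
  rw [dualMetric_eq_sum hh hE, PiLp.inner_apply]
  simp only [frameForm, sum_apply, smul_apply, smul_eq_mul, Finset.mul_sum]
  rw [Finset.sum_comm]
  refine Finset.sum_congr rfl fun l _ => ?_
  have h1 : α x (E l x) = ∑ j, h x (E j x) (E l x) * α x (E j x) := by
    conv_lhs => rw [hE x (E l x), map_sum]
    exact Finset.sum_congr rfl fun j _ => by rw [map_smul, smul_eq_mul]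
  change k x l * α x (E l x) = _
  rw [h1, Finset.mul_sum]
  exact Finset.sum_congr rfl fun j _ => by rw [hh.symm]; ring

theorem enorm_frameCoord_sq (hh : IsSmoothMetric I h) (hE : IsParseval h E) (α : OneForm I M)
    (x : M) : ‖frameCoord E α x‖ₑ ^ 2 = ENNReal.ofReal (dualMetric I h x (α x) (α x)) := by
  rw [← inner_frameCoord hh hE, real_inner_self_eq_norm_sq, ENNReal.ofReal_pow (norm_nonneg _),
    ofReal_norm]

theorem eLpNorm_frameCoord_sq (hh : IsSmoothMetric I h) (hE : IsParseval h E) (α : OneForm I M) :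
    eLpNorm (frameCoord E α) 2 μ ^ 2 =
      ∫⁻ x, ENNReal.ofReal (dualMetric I h x (α x) (α x)) ∂μ := by
  simp_rw [← enorm_frameCoord_sq hh hE]
  rw [eLpNorm_eq_lintegral_rpow_enorm_toReal (by norm_num) (by norm_num), ← ENNReal.rpow_natCast,
    ← ENNReal.rpow_mul]
  simp

theorem aestronglyMeasurable_frameCoord (hE : ∀ i, IsMeasurableField μ (E i)) {α : OneForm I M}
    (hα : IsMeasurableForm μ α) : AEStronglyMeasurable (frameCoord E α) μ :=
  (PiLp.continuous_toLp 2 _).comp_aestronglyMeasurable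
    (aemeasurable_pi_lambda _ fun j => hE j α hα).aestronglyMeasurable

theorem memLp_frameCoord (hh : IsSmoothMetric I h) (hE : IsParseval h E)
    (hEm : ∀ i, IsMeasurableField μ (E i)) {α : OneForm I M} (hα : MemL2OneForm I h μ α) :
    MemLp (frameCoord E α) 2 μ := by
  refine ⟨aestronglyMeasurable_frameCoord hEm hα.measurable, ?_⟩
  have h1 := hα.sq_integrable
  rw [← eLpNorm_frameCoord_sq hh hE] at h1
  exact (ENNReal.pow_lt_top_iff.1 h1).resolve_right two_ne_zero

/-- `frameForm` followed by `frameCoord` is the pointwise orthogonal projection onto the components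
of one-forms. It fixes the components of β and does not increase lengths. -/
theorem norm_frameCoord_sub_frameForm_le (hh : IsSmoothMetric I h) (hE : IsParseval h E)
    (β : OneForm I M) (k : M → EuclideanSpace ℝ (Fin n)) (x : M) :
    ‖frameCoord E (fun x => β x - frameForm h E k x) x‖ ≤ ‖frameCoord E β x - k x‖ := by
  have h1 : β x - frameForm h E k x = ∑ l, (frameCoord E β x - k x) l • h x (E l x) := by
    have h2 : β x = ∑ l, β x (E l x) • h x (E l x) := by
      ext v
      conv_lhs => rw [hE x v, map_sum]
      simp only [sum_apply, smul_apply, map_smul, smul_eq_mul]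
      exact Finset.sum_congr rfl fun j _ => mul_comm _ _
    conv_lhs => rw [h2, frameForm]
    rw [← Finset.sum_sub_distrib]
    exact Finset.sum_congr rfl fun l _ => (sub_smul _ _ _).symm
  rw [EuclideanSpace.norm_eq, EuclideanSpace.norm_eq]
  refine Real.sqrt_le_sqrt ?_
  simp only [Real.norm_eq_abs, sq_abs]
  have h3 := sum_sq_frame_proj_le (E := EuclideanSpace ℝ (Fin d)) (h x) (hh.symm x)
    (fun j => E j x) (hE x) (fun l => (frameCoord E β x - k x) l)
  refine le_trans (le_of_eq ?_) h3
  refine Finset.sum_congr rfl fun j _ => congrArg (· ^ 2) ?_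
  exact congrArg (fun L : EuclideanSpace ℝ (Fin d) →L[ℝ] ℝ => L (E j x)) h1

theorem isMeasurableForm_frameForm (hh : IsSmoothMetric I h)
    (hEm : ∀ i, IsMeasurableField μ (E i)) {k : M → EuclideanSpace ℝ (Fin n)}
    (hk : AEStronglyMeasurable k μ) : IsMeasurableForm μ (frameForm h E k) := by
  intro X hX
  simp only [frameForm, sum_apply, smul_apply, smul_eq_mul]
  refine Finset.aemeasurable_fun_sum _ fun j _ => ?_
  refine AEMeasurable.mul ?_ (hh.isMeasurableForm_flat (hEm j) X hX)
  exact ((EuclideanSpace.proj j : EuclideanSpace ℝ (Fin n) →L[ℝ] ℝ).continuous.comp_aestronglyMeasurable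
    hk).aemeasurable

theorem memL2OneForm_frameForm (hh : IsSmoothMetric I h) (hE : IsParseval h E)
    (hEm : ∀ i, IsMeasurableField μ (E i)) {k : M → EuclideanSpace ℝ (Fin n)}
    (hk : MemLp k 2 μ) : MemL2OneForm I h μ (frameForm h E k) := by
  refine ⟨isMeasurableForm_frameForm hh hEm hk.1, ?_⟩
  rw [← eLpNorm_frameCoord_sq hh hE]
  refine ENNReal.pow_lt_top (lt_of_le_of_lt (eLpNorm_mono fun x => ?_) hk.2)
  -- The contraction estimate with β = 0.
  have h1 := norm_frameCoord_sub_frameForm_le hh hE (fun x => 0) k x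
  have h2 : frameCoord E (fun x => (0 : TangentSpace I x →L[ℝ] ℝ) - frameForm h E k x) x =
      -frameCoord E (frameForm h E k) x := by
    ext j
    simp [frameCoord]
  have h3 : frameCoord E (fun x => (0 : TangentSpace I x →L[ℝ] ℝ)) x = 0 := by
    ext j
    simp [frameCoord]
  rwa [h2, h3, norm_neg, zero_sub, norm_neg] at h1

theorem frameCoord_sub (α β : OneForm I M) :
    frameCoord E (fun x => α x - β x) = frameCoord E α - frameCoord E β := by
  funext x
  ext j
  simp [frameCoord]

theorem extDer_add {v w : M → ℝ} (hv : ContMDiff I 𝓘(ℝ, ℝ) ∞ v) (hw : ContMDiff I 𝓘(ℝ, ℝ) ∞ w)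
    (x : M) : extDer I (v + w) x = extDer I v x + extDer I w x :=
  mfderiv_add (hv.mdifferentiableAt (by simp)) (hw.mdifferentiableAt (by simp))

theorem extDer_smul {w : M → ℝ} (hw : ContMDiff I 𝓘(ℝ, ℝ) ∞ w) (c : ℝ)
    (x : M) : extDer I (c • w) x = c • extDer I w x :=
  const_smul_mfderiv (hw.mdifferentiableAt (by simp)) c

/-- In coordinates `h⁻¹(α, β) = ∑ α_i (G⁻¹ β)_i`. -/
theorem dualMetric_eq_coord (hh : IsSmoothMetric I h) (hE : IsParseval h E) (x₀ : M) {x : M}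
    (hx : x ∈ (extChartAt I x₀).source) (α β : TangentSpace I x →L[ℝ] ℝ) :
    dualMetric I h x α β = ∑ i, ((coordGram h x₀ x)⁻¹ *ᵥ fun j => β (coordField I x₀ j x)) i *
      α (coordField I x₀ i x) := by
  set b : Fin d → ℝ := fun j => β (coordField I x₀ j x) with hb
  set c := (coordGram h x₀ x)⁻¹ *ᵥ b with hc
  set v := ∑ i, c i • coordField I x₀ i x with hv
  have hdet : IsUnit (coordGram h x₀ x).det := (hh.det_coordGram_pos x₀ hx).ne'.isUnit
  have h1 : ∀ j, h x v (coordField I x₀ j x) = β (coordField I x₀ j x) := by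
    intro j
    have h2 : coordGram h x₀ x *ᵥ c = b := by
      rw [hc, Matrix.mulVec_mulVec, Matrix.mul_nonsing_inv _ hdet, Matrix.one_mulVec]
    have h3 := congrFun h2 j
    change _ = b j
    rw [← h3]
    simp only [hv, map_sum, map_smul, sum_apply, smul_apply, smul_eq_mul, Matrix.mulVec,
      dotProduct, coordGram, Matrix.of_apply]
    exact Finset.sum_congr rfl fun i _ => by rw [hh.symm, mul_comm]
  have h2 : ∀ u, h x v u = β u := by
    intro u
    obtain ⟨a, rfl⟩ := exists_eq_sum_coordField x₀ hx u
    simp only [map_sum, map_smul, h1]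
  rw [dualMetric_eq_sum hh hE]
  have h3 : α v = ∑ j, α (E j x) * β (E j x) := by
    conv_lhs => rw [hE x v, map_sum]
    exact Finset.sum_congr rfl fun j _ => by rw [map_smul, hh.symm, h2, smul_eq_mul, mul_comm]
  rw [← h3, hv, map_sum]
  exact Finset.sum_congr rfl fun i _ => by rw [map_smul, smul_eq_mul]

/-- The frame is merely measurable, so the Parseval sum does not show continuity. In coordinates the
inverse Gram matrix is the adjugate over a nonvanishing determinant, with continuous entries. -/
theorem continuous_dualMetric (hh : IsSmoothMetric I h) (hE : IsParseval h E) {v w : M → ℝ}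
    (hv : ContMDiff I 𝓘(ℝ, ℝ) ∞ v) (hw : ContMDiff I 𝓘(ℝ, ℝ) ∞ w) :
    Continuous fun x => dualMetric I h x (extDer I v x) (extDer I w x) := by
  refine continuous_iff_continuousAt.2 fun x₀ => ?_
  refine ContinuousOn.continuousAt (s := (extChartAt I x₀).source) ?_
    (extChartAt_source_mem_nhds x₀)
  have h1 : ∀ {f : M → ℝ}, ContMDiff I 𝓘(ℝ, ℝ) ∞ f → ∀ i, ContinuousOn
      (fun x => extDer I f x (coordField I x₀ i x)) (extChartAt I x₀).source := fun hf i =>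
    (contMDiffOn_extDer_apply hf (contMDiffOn_coordField x₀ i)).continuousOn
  have hG : ContinuousOn (coordGram h x₀) (extChartAt I x₀).source :=
    continuousOn_pi.2 fun i => continuousOn_pi.2 fun j =>
      (hh.smooth _ _ _ (contMDiffOn_coordField x₀ i) (contMDiffOn_coordField x₀ j)).continuousOn
  have hadj : ∀ i j, ContinuousOn (fun x => (coordGram h x₀ x).adjugate i j)
      (extChartAt I x₀).source := fun i j =>
    ((continuous_id.matrix_adjugate.matrix_elem i j).comp_continuousOn hG)
  refine ContinuousOn.congr ?_ fun x hx => dualMetric_eq_coord hh hE x₀ hx _ _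
  simp only [Matrix.inv_def, Ring.inverse_eq_inv', Matrix.mulVec, dotProduct, Matrix.smul_apply,
    smul_eq_mul]
  refine continuousOn_finsetSum _ fun i _ => ContinuousOn.mul
    (continuousOn_finsetSum _ fun j _ => ContinuousOn.mul (ContinuousOn.mul ?_ (hadj i j))
      (h1 hw j)) (h1 hv i)
  exact (hh.contMDiffOn_det_coordGram x₀).continuousOn.inv₀
    fun x hx => (hh.det_coordGram_pos x₀ hx).ne'

theorem memL2OneForm_extDer [CompactSpace M] [IsFiniteMeasure μ] (hh : IsSmoothMetric I h)
    (hE : IsParseval h E) {w : M → ℝ} (hw : ContMDiff I 𝓘(ℝ, ℝ) ∞ w) : MemL2OneForm I h μ (extDer I w) := by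
  refine ⟨isMeasurableForm_extDer hw, ?_⟩
  obtain ⟨C, hC⟩ := isCompact_univ.exists_bound_of_continuousOn
    (continuous_dualMetric hh hE hw hw).continuousOn
  refine lt_of_le_of_lt (lintegral_mono fun x => ENNReal.ofReal_le_ofReal
    ((le_abs_self _).trans (hC x (mem_univ x)))) ?_
  rw [lintegral_const]
  exact ENNReal.mul_lt_top ENNReal.ofReal_lt_top (measure_lt_top _ _)

end LagrangianHeat

/-! ### Integration and integration by parts in charts -/

namespace LagrangianHeat

variable {d : ℕ}
  {H : Type*} [TopologicalSpace H] {I : ModelWithCorners ℝ (EuclideanSpace ℝ (Fin d)) H}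
  {M : Type*} [TopologicalSpace M] [ChartedSpace H M]
  [IsManifold I ∞ M] [MeasurableSpace M] [BorelSpace M]
  {h : BilinField I M} {r : M → ℝ}

/-- The boundary of a chart domain in the model space is a null set. -/
theorem volume_target_inter_preimage_diff_interior (p : M) {U : Set M} (hU : IsOpen U) :
    volume (((extChartAt I p).target ∩ (extChartAt I p).symm ⁻¹' U) \
      interior ((extChartAt I p).target ∩ (extChartAt I p).symm ⁻¹' U)) = 0 := by
  set O : Set (EuclideanSpace ℝ (Fin d)) :=
    I.symm ⁻¹' ((chartAt H p).target ∩ (chartAt H p).symm ⁻¹' U) with hO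
  have h1 : IsOpen O :=
    ((chartAt H p).symm.isOpen_inter_preimage hU).preimage I.continuous_symm
  have h2 : (extChartAt I p).target ∩ (extChartAt I p).symm ⁻¹' U = O ∩ range I := by
    rw [extChartAt_target, hO, extChartAt_coe_symm]
    ext y
    simp only [mem_inter_iff, mem_preimage, Function.comp_apply]
    tauto
  rw [h2, interior_inter, h1.interior_eq]
  -- Only points of the frontier of `range I` can fail to be interior, and a convex set has a null
  -- frontier.
  refine measure_mono_null ?_ (I.convex_range.addHaar_frontier volume)
  rintro y ⟨⟨hy1, hy2⟩, hy3⟩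
  exact ⟨subset_closure hy2, fun h => hy3 ⟨hy1, h⟩⟩

theorem IsSmoothMetric.continuousOn_weight (hh : IsSmoothMetric I h) (hr : Continuous r) (p : M) :
    ContinuousOn (fun y => volDensity I h p y * r ((extChartAt I p).symm y))
      (extChartAt I p).target :=
  (hh.contDiffOn_volDensity p).continuousOn.mul
    (hr.comp_continuousOn (continuousOn_extChartAt_symm p))

theorem aemeasurable_weight (hh : IsSmoothMetric I h) (hr : Continuous r) (p : M) :
    AEMeasurable (fun y => ENNReal.ofReal (volDensity I h p y * r ((extChartAt I p).symm y)))
      ((volume : Measure (EuclideanSpace ℝ (Fin d))).restrict (extChartAt I p).target) :=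
  ((hh.continuousOn_weight hr p).aemeasurable (measurableSet_extChartAt_target p)).ennreal_ofReal

/-- Integration in a chart. -/
theorem setIntegral_source (hh : IsSmoothMetric I h) (hr : Continuous r) (hr0 : ∀ x, 0 < r x)
    (p : M) {f : M → ℝ} (hf : AEStronglyMeasurable f (densityMeasure h r)) :
    ∫ x in (extChartAt I p).source, f x ∂(densityMeasure h r) =
      ∫ y in (extChartAt I p).target,
        volDensity I h p y * r ((extChartAt I p).symm y) * f ((extChartAt I p).symm y) := by
  have hf' := hf.mono_measure (Measure.restrict_le_self (s := (extChartAt I p).source))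
  rw [densityMeasure_restrict_source hh hr p] at hf' ⊢
  rw [integral_map ((aemeasurable_extChartAt_symm p).mono_ac
    (withDensity_absolutelyContinuous _ _)) hf',
    integral_withDensity_eq_integral_toReal_smul₀ (aemeasurable_weight hh hr p)
      (ae_of_all _ fun _ => ENNReal.ofReal_lt_top)]
  refine setIntegral_congr_fun (measurableSet_extChartAt_target p) fun y hy => ?_
  simp only [smul_eq_mul]
  rw [ENNReal.toReal_ofReal (mul_pos (hh.volDensity_pos p hy) (hr0 _)).le]

/-- The weight √det h · r is positive and continuous on the chart target, but its inverse may be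
unbounded near the edge. Dividing by it keeps local integrability only. -/
theorem locallyIntegrableOn_comp_symm (hh : IsSmoothMetric I h) (hr : Continuous r)
    (hr0 : ∀ x, 0 < r x) (p : M) {f : M → ℝ} (hf : Integrable f (densityMeasure h r)) :
    LocallyIntegrableOn (fun y => f ((extChartAt I p).symm y))
      (interior (extChartAt I p).target) := by
  have hf' := hf.integrableOn (s := (extChartAt I p).source)
  rw [IntegrableOn, densityMeasure_restrict_source hh hr p,
    integrable_map_measure (by
      have := hf.1.mono_measure (Measure.restrict_le_self (s := (extChartAt I p).source))
      rwa [densityMeasure_restrict_source hh hr p] at this)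
      ((aemeasurable_extChartAt_symm p).mono_ac (withDensity_absolutelyContinuous _ _)),
    integrable_withDensity_iff_integrable_smul₀' (aemeasurable_weight hh hr p)
      (ae_of_all _ fun _ => ENNReal.ofReal_lt_top)] at hf'
  have h1 := (IntegrableOn.mono_set hf' (interior_subset (s :=
    (extChartAt I p).target))).locallyIntegrableOn
  have h2 : ContinuousOn (fun y => (volDensity I h p y * r ((extChartAt I p).symm y))⁻¹)
      (interior (extChartAt I p).target) :=
    ((hh.continuousOn_weight hr p).mono interior_subset).inv₀ fun y hy =>
      (mul_pos (hh.volDensity_pos p (interior_subset hy)) (hr0 _)).ne'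
  have h3 := h1.continuousOn_mul h2 isOpen_interior.isLocallyClosed
  intro y hy
  obtain ⟨t, ht, hti⟩ := h3 y hy
  refine ⟨t ∩ interior (extChartAt I p).target, inter_mem ht self_mem_nhdsWithin, ?_⟩
  refine (hti.mono_set inter_subset_left).congr (ae_restrict_of_ae_restrict_of_subset
    inter_subset_right ?_)
  filter_upwards [ae_restrict_mem isOpen_interior.measurableSet] with z hz
  have h4 := mul_pos (hh.volDensity_pos p (interior_subset hz)) (hr0 ((extChartAt I p).symm z))
  rw [ENNReal.toReal_ofReal h4.le, smul_eq_mul, inv_mul_cancel_left₀ h4.ne']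
  rfl

theorem ae_restrict_source (hh : IsSmoothMetric I h) (hr : Continuous r) (p : M)
    {f : M → ℝ} (hf : AEMeasurable f (densityMeasure h r))
    (h0 : ∀ᵐ y ∂(volume : Measure (EuclideanSpace ℝ (Fin d))).restrict (extChartAt I p).target,
      f ((extChartAt I p).symm y) = 0) :
    ∀ᵐ x ∂(densityMeasure h r).restrict (extChartAt I p).source, f x = 0 := by
  have hf' := hf.mono_measure (Measure.restrict_le_self (s := (extChartAt I p).source))
  rw [densityMeasure_restrict_source hh hr p] at hf' ⊢
  have h1 : ∀ᵐ x ∂((((volume : Measure (EuclideanSpace ℝ (Fin d))).restrict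
        (extChartAt I p).target).withDensity fun y =>
          ENNReal.ofReal (volDensity I h p y * r ((extChartAt I p).symm y))).map
        (extChartAt I p).symm), ‖f x‖ₑ = 0 := by
    refine (lintegral_eq_zero_iff' hf'.enorm).1 ?_
    rw [lintegral_map' hf'.enorm ((aemeasurable_extChartAt_symm p).mono_ac
      (withDensity_absolutelyContinuous _ _))]
    rw [lintegral_congr_ae (g := fun _ => 0), lintegral_zero]
    filter_upwards [(withDensity_absolutelyContinuous _ _).ae_le h0] with y hy
    rw [hy, enorm_zero]
  filter_upwards [h1] with x hx
  exact enorm_eq_zero.1 hx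

/-- The function on `M` with compact support in a chart domain for which integration against
`r dω_h` is integration against `φ` in coordinates. -/
noncomputable def chartTest (h : BilinField I M) (r : M → ℝ) (p : M)
    (φ : EuclideanSpace ℝ (Fin d) → ℝ) : M → ℝ :=
  (extChartAt I p).source.indicator fun x =>
    (volDensity I h p (extChartAt I p x) * r x)⁻¹ * φ (extChartAt I p x)

variable {p : M} {φ : EuclideanSpace ℝ (Fin d) → ℝ}

theorem memLp_top_chartTest (hh : IsSmoothMetric I h) (hr : Continuous r) (hr0 : ∀ x, 0 < r x)
    (hφ : Continuous φ) (hc : HasCompactSupport φ) (hs : tsupport φ ⊆ (extChartAt I p).target)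
    (μ : Measure M) : MemLp (chartTest h r p φ) ⊤ μ := by
  classical
  have hκ : ContinuousOn (fun y => (volDensity I h p y * r ((extChartAt I p).symm y))⁻¹ * φ y)
      (extChartAt I p).target :=
    ((hh.continuousOn_weight hr p).inv₀ fun y hy =>
      (mul_pos (hh.volDensity_pos p hy) (hr0 _)).ne').mul hφ.continuousOn
  obtain ⟨C, hC⟩ := hc.isCompact.exists_bound_of_continuousOn (hκ.mono hs)
  have hψ : ∀ x ∈ (extChartAt I p).source,
      (volDensity I h p (extChartAt I p x) * r x)⁻¹ * φ (extChartAt I p x) =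
      (volDensity I h p (extChartAt I p x) * r ((extChartAt I p).symm (extChartAt I p x)))⁻¹ *
        φ (extChartAt I p x) := fun x hx => by rw [(extChartAt I p).left_inv hx]
  refine memLp_top_of_bound (Measurable.aestronglyMeasurable ?_) (max C 0)
    (ae_of_all _ fun x => ?_)
  · rw [chartTest, ← piecewise_eq_indicator]
    exact ContinuousOn.measurable_piecewise
      ((hκ.comp (continuousOn_extChartAt p) (extChartAt I p).mapsTo).congr hψ) continuousOn_const
      (isOpen_extChartAt_source p).measurableSet
  · by_cases hx : x ∈ (extChartAt I p).source
    · rw [chartTest, indicator_of_mem hx]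
      by_cases hy : extChartAt I p x ∈ tsupport φ
      · rw [hψ x hx]
        exact (hC _ hy).trans (le_max_left _ _)
      · rw [image_eq_zero_of_notMem_tsupport hy, mul_zero, norm_zero]
        exact le_max_right _ _
    · rw [chartTest, indicator_of_notMem hx, norm_zero]
      exact le_max_right _ _

theorem integral_chartTest_mul (hh : IsSmoothMetric I h) (hr : Continuous r)
    (hr0 : ∀ x, 0 < r x) (hφ : Continuous φ) (hc : HasCompactSupport φ)
    (hs : tsupport φ ⊆ (extChartAt I p).target)
    {f : M → ℝ} (hf : AEStronglyMeasurable f (densityMeasure h r)) :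
    ∫ x, chartTest h r p φ x * f x ∂(densityMeasure h r) =
      ∫ y, φ y * f ((extChartAt I p).symm y) := by
  rw [← setIntegral_eq_integral_of_forall_compl_eq_zero (s := (extChartAt I p).source)
    fun x hx => by rw [chartTest, indicator_of_notMem hx, zero_mul],
    setIntegral_source (f := fun x => chartTest h r p φ x * f x) hh hr hr0 p ((memLp_top_chartTest hh hr hr0 hφ hc hs _).1.mul hf),
    ← setIntegral_eq_integral_of_forall_compl_eq_zero (s := (extChartAt I p).target)
    (f := fun y => φ y * f ((extChartAt I p).symm y)) fun y hy => by rw [image_eq_zero_of_notMem_tsupport fun h => hy (hs h), zero_mul]]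
  refine setIntegral_congr_fun (measurableSet_extChartAt_target p) fun y hy => ?_
  have h1 := mul_pos (hh.volDensity_pos p hy) (hr0 ((extChartAt I p).symm y))
  simp only [chartTest, indicator_of_mem ((extChartAt I p).map_target hy),
    (extChartAt I p).right_inv hy]
  rw [mul_assoc _⁻¹, mul_inv_cancel_left₀ h1.ne']

/-- Integration by parts for a coordinate field. -/
theorem integral_chartTest_mul_extDer (hh : IsSmoothMetric I h) (hr : Continuous r)
    (hr0 : ∀ x, 0 < r x) (hφ : ContDiff ℝ ∞ φ) (hc : HasCompactSupport φ) {U : Set M}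
    (hs : tsupport φ ⊆ interior ((extChartAt I p).target ∩ (extChartAt I p).symm ⁻¹' U))
    {X : ∀ x : M, TangentSpace I x}
    (hX : ContMDiff I I.tangent ∞ (fun x => (⟨x, X x⟩ : TangentBundle I M))) {i : Fin d}
    (hXU : ∀ x ∈ U, X x = coordField I p i x) {w : M → ℝ} (hw : ContMDiff I 𝓘(ℝ, ℝ) ∞ w) :
    ∫ x, chartTest h r p φ x * extDer I w x (X x) ∂(densityMeasure h r) =
      -∫ x, chartTest h r p (fun y => fderiv ℝ φ y (EuclideanSpace.single i 1)) x * w x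
        ∂(densityMeasure h r) := by
  set e : EuclideanSpace ℝ (Fin d) := EuclideanSpace.single i 1 with he
  set Q := interior ((extChartAt I p).target ∩ (extChartAt I p).symm ⁻¹' U) with hQ
  have hQt : Q ⊆ (extChartAt I p).target := interior_subset.trans inter_subset_left
  have hdφ : Continuous fun y => fderiv ℝ φ y e :=
    (hφ.continuous_fderiv (by simp)).clm_apply continuous_const
  have hdc : HasCompactSupport fun y => fderiv ℝ φ y e := hc.fderiv_apply (𝕜 := ℝ) e
  have hds : tsupport (fun y => fderiv ℝ φ y e) ⊆ tsupport φ := tsupport_fderiv_apply_subset ℝ e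
  rw [integral_chartTest_mul hh hr hr0 hφ.continuous hc (hs.trans hQt)
      (contMDiff_extDer_apply hw hX).continuous.measurable.aestronglyMeasurable,
    integral_chartTest_mul hh hr hr0 hdφ hdc ((hds.trans hs).trans hQt)
      hw.continuous.measurable.aestronglyMeasurable]
  set g : EuclideanSpace ℝ (Fin d) → ℝ := fun y => w ((extChartAt I p).symm y) with hg
  have hgQ : ContDiffOn ℝ ∞ g Q :=
    contMDiffOn_iff_contDiffOn.1 (hw.comp_contMDiffOn
      ((contMDiffOn_extChartAt_symm p).mono hQt))
  have h1 : ∀ y ∈ Q, extDer I w ((extChartAt I p).symm y) (X ((extChartAt I p).symm y)) =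
      fderiv ℝ g y e := by
    intro y hy
    have hyU : (extChartAt I p).symm y ∈ U := (interior_subset hy).2
    have hr : range I ∈ 𝓝 y := mem_of_superset (isOpen_interior.mem_nhds hy)
      (hQt.trans (extChartAt_target_subset_range p))
    have h3 := (hw.mdifferentiableAt (x := (extChartAt I p).symm y)
      (by simp)).hasMFDerivAt.comp_hasMFDerivWithinAt y
      (mdifferentiableWithinAt_extChartAt_symm (I := I) (hQt hy)).hasMFDerivWithinAt
    have h4 : HasFDerivWithinAt g (show EuclideanSpace ℝ (Fin d) →L[ℝ] ℝ from
        (mfderiv I 𝓘(ℝ, ℝ) w ((extChartAt I p).symm y)).comp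
          (mfderivWithin 𝓘(ℝ, EuclideanSpace ℝ (Fin d)) I (extChartAt I p).symm (range I) y))
        (range I) y := hasMFDerivWithinAt_iff_hasFDerivWithinAt.1 h3
    rw [hXU _ hyU, ← coordVec_eq p (hQt hy), (h4.hasFDerivAt hr).fderiv]
    rfl
  have hdg : ContinuousOn (fun y => fderiv ℝ g y e) Q :=
    (hgQ.continuousOn_fderiv_of_isOpen isOpen_interior (by simp)).clm_apply continuousOn_const
  have h2 : ∀ {a b : EuclideanSpace ℝ (Fin d) → ℝ}, Continuous a → HasCompactSupport a →
      tsupport a ⊆ Q → ContinuousOn b Q → Integrable (fun y => a y * b y) := by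
    intro a b ha hac has hb
    refine Continuous.integrable_of_hasCompactSupport ?_ hac.mul_right
    exact ContinuousOn.continuous_of_tsupport_subset (ha.continuousOn.mul hb) isOpen_interior
      ((tsupport_mul_subset_left).trans has)
  -- There is no boundary term: φ has compact support in the open set `Q`, and w in coordinates is
  -- smooth on `Q`.
  rw [← integral_mul_fderiv_eq_neg_fderiv_mul_of_integrable
    (h2 hdφ hdc (hds.trans hs) hgQ.continuousOn) (h2 hφ.continuous hc hs hdg)
    (h2 hφ.continuous hc hs hgQ.continuousOn)
    (fun y _ => hφ.differentiable (by simp) y)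
    fun y hy => (hgQ.contDiffAt (isOpen_interior.mem_nhds (hs hy))).differentiableAt (by simp)]
  refine integral_congr_ae (ae_of_all _ fun y => ?_)
  by_cases hy : y ∈ Q
  · simp only [h1 y hy]
  · simp only [image_eq_zero_of_notMem_tsupport fun h => hy (hs h), zero_mul]

end LagrangianHeat

/-! ### Closability of the exterior derivative -/

namespace LagrangianHeat

variable {d : ℕ}
  {H : Type*} [TopologicalSpace H] {I : ModelWithCorners ℝ (EuclideanSpace ℝ (Fin d)) H}
  {M : Type*} [TopologicalSpace M] [ChartedSpace H M]
  [IsManifold I ∞ M] [MeasurableSpace M] [BorelSpace M]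
  {h : BilinField I M} {r : M → ℝ}
  {n : ℕ} {E : Fin n → ∀ x : M, TangentSpace I x} {μ : Measure M}

/-- The graph of the exterior derivative on smooth functions, where one-forms are represented by
their components in a frame. -/
noncomputable def extDerGraph (E : Fin n → ∀ x : M, TangentSpace I x) (μ : Measure M) :
    Submodule ℝ (WithLp 2 (Lp ℝ 2 μ × Lp (EuclideanSpace ℝ (Fin n)) 2 μ)) where
  carrier := {p | ∃ w : M → ℝ, ContMDiff I 𝓘(ℝ, ℝ) ∞ w ∧ p.fst =ᵐ[μ] w ∧
    p.snd =ᵐ[μ] frameCoord E (extDer I w)}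
  add_mem' := by
    rintro p q ⟨v, hv, hv1, hv2⟩ ⟨w, hw, hw1, hw2⟩
    refine ⟨v + w, hv.add hw, ?_, ?_⟩
    · exact (Lp.coeFn_add p.fst q.fst).trans (hv1.add hw1)
    · refine (Lp.coeFn_add p.snd q.snd).trans ((hv2.add hw2).trans (ae_of_all _ fun x => ?_))
      ext j
      simp [frameCoord, extDer_add hv hw]
  zero_mem' := by
    refine ⟨fun _ => 0, contMDiff_const, Lp.coeFn_zero .., ?_⟩
    refine (Lp.coeFn_zero ..).trans (ae_of_all _ fun x => ?_)
    ext j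
    have h1 : extDer I (fun _ : M => (0 : ℝ)) x = 0 := mfderiv_const
    simp [frameCoord, h1]
  smul_mem' := by
    rintro c p ⟨w, hw, hw1, hw2⟩
    have hcw : ContMDiff I 𝓘(ℝ, ℝ) ∞ fun x => c • w x :=
      (contDiff_const_smul (𝕜 := ℝ) (F := ℝ) c).contMDiff.comp hw
    refine ⟨c • w, hcw, ?_, ?_⟩
    · exact (Lp.coeFn_smul c p.fst).trans (hw1.const_smul c)
    · refine (Lp.coeFn_smul c p.snd).trans ((hw2.const_smul c).trans (ae_of_all _ fun x => ?_))
      ext j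
      simp [frameCoord, extDer_smul hw]

/-- The orthogonality condition is closed; this is how identities pass from smooth functions to
their limits. -/
theorem inner_add_inner_eq_zero_of_mem_closure
    {D : Submodule ℝ (WithLp 2 (Lp ℝ 2 μ × Lp (EuclideanSpace ℝ (Fin n)) 2 μ))}
    {a : Lp ℝ 2 μ} {b : Lp (EuclideanSpace ℝ (Fin n)) 2 μ}
    (h0 : ∀ p ∈ D, ⟪a, p.fst⟫_ℝ + ⟪b, p.snd⟫_ℝ = 0)
    {p : WithLp 2 (Lp ℝ 2 μ × Lp (EuclideanSpace ℝ (Fin n)) 2 μ)} (hp : p ∈ D.topologicalClosure) :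
    ⟪a, p.fst⟫_ℝ + ⟪b, p.snd⟫_ℝ = 0 := by
  have hcl : IsClosed {p : WithLp 2 (Lp ℝ 2 μ × Lp (EuclideanSpace ℝ (Fin n)) 2 μ) |
      ⟪a, p.fst⟫_ℝ + ⟪b, p.snd⟫_ℝ = 0} := by
    refine isClosed_eq ?_ continuous_const
    have hf := (WithLp.prod_continuous_ofLp 2 (Lp ℝ 2 μ) (Lp (EuclideanSpace ℝ (Fin n)) 2 μ))
    exact (continuous_const.inner hf.fst).add (continuous_const.inner hf.snd)
  exact closure_minimal (s := (D : Set _)) (fun p hp => h0 p hp) hcl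
    (by rwa [← Submodule.topologicalClosure_coe])

theorem dualMetric_flat_left (hh : IsSmoothMetric I h) (hE : IsParseval h E) (x : M)
    (v : TangentSpace I x) (β : TangentSpace I x →L[ℝ] ℝ) :
    dualMetric I h x (h x v) β = β v := by
  rw [dualMetric_eq_sum hh hE]
  conv_rhs => rw [hE x v, map_sum]
  exact Finset.sum_congr rfl fun j _ => by rw [map_smul, hh.symm, smul_eq_mul]

theorem memL2OneForm_flat [CompactSpace M] [IsFiniteMeasure μ] (hh : IsSmoothMetric I h)
    (hE : IsParseval h E) {X : ∀ x : M, TangentSpace I x}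
    (hX : ContMDiff I I.tangent ∞ (fun x => (⟨x, X x⟩ : TangentBundle I M))) :
    MemL2OneForm I h μ (fun x => h x (X x)) := by
  refine ⟨hh.isMeasurableForm_flat (isMeasurableField_of_contMDiff hX), ?_⟩
  simp_rw [dualMetric_flat_left hh hE]
  have hc : Continuous fun x => h x (X x) (X x) :=
    (contMDiffOn_univ.1 (hh.smooth univ X X hX.contMDiffOn hX.contMDiffOn)).continuous
  obtain ⟨C, hC⟩ := isCompact_univ.exists_bound_of_continuousOn hc.continuousOn
  refine lt_of_le_of_lt (lintegral_mono fun x => ENNReal.ofReal_le_ofReal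
    ((le_abs_self _).trans (hC x (mem_univ x)))) ?_
  rw [lintegral_const]
  exact ENNReal.mul_lt_top ENNReal.ofReal_lt_top (measure_lt_top _ _)

section Closable

variable [CompactSpace M] [T2Space M] (hh : IsSmoothMetric I h) (hr : Continuous r)
  (hr0 : ∀ x, 0 < r x) (hE : IsParseval h E)
  (hEm : ∀ i, IsMeasurableField (densityMeasure h r) (E i))
  {k : Lp (EuclideanSpace ℝ (Fin n)) 2 (densityMeasure h r)}
  (hk : WithLp.toLp 2 (0, k) ∈ (extDerGraph E (densityMeasure h r)).topologicalClosure)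

include hh hr hr0 hE hEm hk in
-- By integration by parts the pair consisting of the test function of ∂_i φ and of X♭ times the
-- test function of φ is orthogonal to the graph of d, hence to its closure. At (0, k) only the
-- second term is left, and in coordinates it is this integral.
theorem integral_test_frameForm_eq_zero {φ : EuclideanSpace ℝ (Fin d) → ℝ} (hφ : ContDiff ℝ ∞ φ)
    (hc : HasCompactSupport φ) {p : M} {U : Set M}
    (hs : tsupport φ ⊆ interior ((extChartAt I p).target ∩ (extChartAt I p).symm ⁻¹' U))
    {X : ∀ x : M, TangentSpace I x}
    (hX : ContMDiff I I.tangent ∞ (fun x => (⟨x, X x⟩ : TangentBundle I M))) {i : Fin d}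
    (hXU : ∀ x ∈ U, X x = coordField I p i x) :
    ∫ y, φ y * frameForm h E k ((extChartAt I p).symm y) (X ((extChartAt I p).symm y)) = 0 := by
  have := isFiniteMeasure_densityMeasure hh hr
  have hst := hs.trans (interior_subset.trans inter_subset_left)
  have hcφ := memLp_top_chartTest hh hr hr0 hφ.continuous hc hst (densityMeasure h r)
  have hdφ : Continuous fun y => fderiv ℝ φ y (EuclideanSpace.single i 1) :=
    (hφ.continuous_fderiv (by simp)).clm_apply continuous_const
  have hcdφ := memLp_top_chartTest hh hr hr0 hdφ (hc.fderiv_apply (𝕜 := ℝ) _)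
    ((tsupport_fderiv_apply_subset ℝ _).trans hst) (densityMeasure h r)
  have hX2 : MemL2OneForm I h (densityMeasure h r) (fun x => h x (X x)) :=
    memL2OneForm_flat hh hE hX
  have hb := memLp_frameCoord hh hE hEm hX2
  have hcb : MemLp (chartTest h r p φ • frameCoord E fun x => h x (X x)) 2 (densityMeasure h r) :=
    hb.smul hcφ
  have ha : MemLp (chartTest h r p fun y => fderiv ℝ φ y (EuclideanSpace.single i 1)) 2
    (densityMeasure h r) := hcdφ.mono_exponent le_top
  have h1 := inner_add_inner_eq_zero_of_mem_closure (a := ha.toLp) (b := hcb.toLp) ?_ hk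
  · have h2 : ⟪ha.toLp, (0 : Lp ℝ 2 (densityMeasure h r))⟫_ℝ + ⟪hcb.toLp, k⟫_ℝ = 0 := h1
    rw [inner_zero_right, zero_add, L2.inner_def] at h2
    rw [← integral_chartTest_mul hh hr hr0 hφ.continuous hc hst
      (f := fun x => frameForm h E k x (X x))
      (isMeasurableForm_frameForm hh hEm (Lp.aestronglyMeasurable k) X hX).aestronglyMeasurable,
      ← h2]
    refine integral_congr_ae ?_
    filter_upwards [hcb.coeFn_toLp] with x hx
    rw [hx, Pi.smul_apply', real_inner_smul_left, inner_frameCoord_left hh hE,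
      dualMetric_flat_left hh hE]
  · rintro q ⟨w, hw, hw1, hw2⟩
    rw [L2.inner_def, L2.inner_def]
    have h3 := integral_chartTest_mul_extDer hh hr hr0 hφ hc hs hX hXU hw
    rw [add_comm, ← eq_neg_iff_add_eq_zero]
    refine Eq.trans ?_ (h3.trans (congrArg Neg.neg ?_))
    · refine integral_congr_ae ?_
      filter_upwards [hcb.coeFn_toLp, hw2] with x hx hx2
      rw [hx, hx2, Pi.smul_apply', real_inner_smul_left, inner_frameCoord hh hE,
        dualMetric_flat_left hh hE]
    · refine integral_congr_ae ?_
      filter_upwards [ha.coeFn_toLp, hw1] with x hx hx1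
      rw [hx, hx1]
      exact mul_comm _ _

include hh hr hr0 hE hEm hk in
-- The fundamental lemma of the calculus of variations in the interior of each chart domain, applied
-- to one cut-off coordinate field at a time; the remaining points form a null set.
theorem frameForm_ae_eq_zero :
    ∀ᵐ x ∂(densityMeasure h r), frameForm h E k x = 0 := by
  have := isFiniteMeasure_densityMeasure hh hr
  obtain ⟨s, -, hs⟩ := isCompact_univ.elim_nhds_subcover
    (fun p : M => (extChartAt I p).source ∩ interior {x | cutoff I p x = 1})
    fun p _ => inter_mem (extChartAt_source_mem_nhds (I := I) p)
      (interior_mem_nhds.2 (cutoff I p).eventuallyEq_one)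
  have key : ∀ p : M, ∀ i : Fin d, ∀ᵐ x ∂(densityMeasure h r), x ∈ (extChartAt I p).source →
      x ∈ interior {x | cutoff I p x = 1} → frameForm h E k x (cutField p i x) = 0 := by
    intro p i
    set U : Set M := interior {x | cutoff I p x = 1} with hU
    have hX := contMDiff_cutField (I := I) p i
    have hXU : ∀ x ∈ U, cutField p i x = coordField I p i x := fun x hx => by
      have : cutoff I p x = 1 := interior_subset (s := {x | cutoff I p x = 1}) hx
      rw [cutField, this, one_smul]
    have hm : AEMeasurable (fun x => frameForm h E k x (cutField p i x)) (densityMeasure h r) :=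
      isMeasurableForm_frameForm hh hEm (Lp.aestronglyMeasurable k) _ hX
    have hint : Integrable (fun x => frameForm h E k x (cutField p i x)) (densityMeasure h r) := by
      have h2 := L2.integrable_inner (𝕜 := ℝ)
        (memLp_frameCoord hh hE hEm (memL2OneForm_flat hh hE hX)).toLp k
      refine h2.congr ?_
      filter_upwards [(memLp_frameCoord hh hE hEm (memL2OneForm_flat hh hE hX)).coeFn_toLp]
        with x hx
      rw [hx, inner_frameCoord_left hh hE, dualMetric_flat_left hh hE]
    set Q := interior ((extChartAt I p).target ∩ (extChartAt I p).symm ⁻¹' U) with hQ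
    have h3 := isOpen_interior.ae_eq_zero_of_integral_contDiff_smul_eq_zero (μ := volume) (U := Q)
      ((locallyIntegrableOn_comp_symm hh hr hr0 p hint).mono_set
        (interior_mono inter_subset_left))
      fun φ hφ hc hs => integral_test_frameForm_eq_zero hh hr hr0 hE hEm hk hφ hc hs hX hXU
    have h4 := ae_restrict_source hh hr p
      (f := U.indicator fun x => frameForm h E k x (cutField p i x))
      (hm.indicator isOpen_interior.measurableSet) ?_
    · rw [ae_restrict_iff' (isOpen_extChartAt_source p).measurableSet] at h4
      filter_upwards [h4] with x hx hxs hxU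
      rw [← hx hxs, indicator_of_mem hxU]
    · have h5 : ∀ᵐ y ∂(volume : Measure (EuclideanSpace ℝ (Fin d))),
          y ∉ ((extChartAt I p).target ∩ (extChartAt I p).symm ⁻¹' U) \ Q :=
        measure_eq_zero_iff_ae_notMem.1
          (volume_target_inter_preimage_diff_interior p isOpen_interior)
      rw [ae_restrict_iff' (measurableSet_extChartAt_target p)]
      filter_upwards [h3, h5] with y hy1 hy2 hy
      by_cases hyU : (extChartAt I p).symm y ∈ U
      · rw [indicator_of_mem hyU]
        exact hy1 (by_contra fun h => hy2 ⟨⟨hy, hyU⟩, h⟩)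
      · exact indicator_of_notMem hyU _
  have key2 : ∀ᵐ x ∂(densityMeasure h r), ∀ p ∈ s, ∀ i : Fin d, x ∈ (extChartAt I p).source →
      x ∈ interior {x | cutoff I p x = 1} → frameForm h E k x (cutField p i x) = 0 :=
    (ae_ball_iff s.countable_toSet).2 fun p _ => ae_all_iff.2 fun i => key p i
  filter_upwards [key2] with x hx
  obtain ⟨p, hp, hxp, hx1⟩ : ∃ p ∈ s, x ∈ (extChartAt I p).source ∧
      x ∈ interior {x | cutoff I p x = 1} := by
    simpa only [mem_iUnion, exists_prop, mem_inter_iff] using hs (mem_univ x)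
  refine ContinuousLinearMap.ext fun v => ?_
  obtain ⟨c, rfl⟩ := exists_eq_sum_coordField p hxp v
  rw [map_sum]
  refine Finset.sum_eq_zero fun i _ => ?_
  have h6 := hx p hp i hxp hx1
  have h7 : cutoff I p x = 1 := interior_subset (s := {x | cutoff I p x = 1}) hx1
  rw [cutField, h7, one_smul] at h6
  rw [map_smul, h6, smul_zero]

include hh hr hr0 hE hEm hk in
/-- The exterior derivative is closable. -/
theorem eq_zero_of_mem_closure_extDerGraph : k = 0 := by
  have h1 := frameForm_ae_eq_zero hh hr hr0 hE hEm hk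
  -- A vanishing `frameForm` leaves open a part of `k` orthogonal to the components of one-forms.
  -- But `k` is a limit of components of differentials, each orthogonal to `k` by `h1`, so `k` is
  -- orthogonal to itself.
  have h2 := inner_add_inner_eq_zero_of_mem_closure (a := 0) (b := k) ?_ hk
  · have h3 : ⟪(0 : Lp ℝ 2 (densityMeasure h r)), 0⟫_ℝ + ⟪k, k⟫_ℝ = 0 := h2
    rwa [inner_zero_left, zero_add, inner_self_eq_zero] at h3
  · rintro q ⟨w, hw, hw1, hw2⟩
    rw [inner_zero_left, zero_add, real_inner_comm, L2.inner_def]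
    refine integral_eq_zero_of_ae ?_
    filter_upwards [h1, hw2] with x hx hx2
    rw [hx2, inner_frameCoord_left hh hE, hx, dualMetric_eq_sum hh hE]
    simp

end Closable

end LagrangianHeat

/-! ### The Laplace–Beltrami operator as T*T -/

namespace LagrangianHeat

variable {d : ℕ}
  {H : Type*} [TopologicalSpace H] {I : ModelWithCorners ℝ (EuclideanSpace ℝ (Fin d)) H}
  {M : Type*} [TopologicalSpace M] [ChartedSpace H M]
  [IsManifold I ∞ M] [MeasurableSpace M] [BorelSpace M]
  {h : BilinField I M}
  {n : ℕ} {E : Fin n → ∀ x : M, TangentSpace I x} {μ : Measure M}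

section

variable [CompactSpace M] [IsFiniteMeasure μ]

theorem memLp_two_of_contMDiff {w : M → ℝ} (hw : ContMDiff I 𝓘(ℝ, ℝ) ∞ w) : MemLp w 2 μ := by
  obtain ⟨C, hC⟩ := isCompact_univ.exists_bound_of_continuousOn hw.continuous.continuousOn
  exact MemLp.of_bound hw.continuous.measurable.aestronglyMeasurable C
    (ae_of_all _ fun x => hC x (mem_univ x))

theorem memLp_frameCoord_extDer (hh : IsSmoothMetric I h) (hE : IsParseval h E)
    (hEm : ∀ i, IsMeasurableField μ (E i)) {w : M → ℝ} (hw : ContMDiff I 𝓘(ℝ, ℝ) ∞ w) :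
    MemLp (frameCoord E (extDer I w)) 2 μ :=
  memLp_frameCoord hh hE hEm (memL2OneForm_extDer hh hE hw)

theorem toLp_mem_extDerGraph (hh : IsSmoothMetric I h) (hE : IsParseval h E)
    (hEm : ∀ i, IsMeasurableField μ (E i)) {w : M → ℝ} (hw : ContMDiff I 𝓘(ℝ, ℝ) ∞ w) :
    WithLp.toLp 2 ((memLp_two_of_contMDiff hw).toLp,
      (memLp_frameCoord_extDer hh hE hEm hw).toLp) ∈ extDerGraph E μ :=
  ⟨w, hw, (memLp_two_of_contMDiff hw).coeFn_toLp,
    (memLp_frameCoord_extDer hh hE hEm hw).coeFn_toLp⟩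

/-- Smooth functions alone are dense: an L² function orthogonal to all of them vanishes almost
everywhere. -/
theorem dense_fst_extDerGraph [T2Space M] (hh : IsSmoothMetric I h) (hE : IsParseval h E)
    (hEm : ∀ i, IsMeasurableField μ (E i)) :
    Dense {u : Lp ℝ 2 μ | ∃ p ∈ (extDerGraph E μ).topologicalClosure, p.fst = u} := by
  let S : Submodule ℝ (Lp ℝ 2 μ) := (extDerGraph E μ).map
    (LinearMap.fst ℝ _ _ ∘ₗ (WithLp.linearEquiv 2 ℝ
      (Lp ℝ 2 μ × Lp (EuclideanSpace ℝ (Fin n)) 2 μ)).toLinearMap)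
  have hS : Dense (S : Set (Lp ℝ 2 μ)) := by
    rw [Submodule.dense_iff_topologicalClosure_eq_top, Submodule.topologicalClosure_eq_top_iff,
      Submodule.eq_bot_iff]
    intro u hu
    have h1 : ∀ᵐ x ∂μ, u x = 0 := by
      refine ae_eq_zero_of_integral_contMDiff_smul_eq_zero I
        (((Lp.memLp u).integrable (by norm_num)).locallyIntegrable) fun w hw _ => ?_
      have h2 := hu _ (Submodule.mem_map_of_mem (toLp_mem_extDerGraph hh hE hEm hw))
      have h3 : ⟪(memLp_two_of_contMDiff (μ := μ) hw).toLp, u⟫_ℝ = 0 := h2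
      rw [L2.inner_def] at h3
      rw [← h3]
      refine integral_congr_ae ?_
      filter_upwards [(memLp_two_of_contMDiff (μ := μ) hw).coeFn_toLp] with x hx
      rw [hx]
      exact mul_comm _ _
    exact (Lp.eq_zero_iff_ae_eq_zero).2 h1
  refine hS.mono ?_
  rintro _ ⟨p, hp, rfl⟩
  exact ⟨p, Submodule.le_topologicalClosure _ hp, rfl⟩

theorem lintegral_dualMetric_sub (hh : IsSmoothMetric I h) (hE : IsParseval h E)
    (α β : OneForm I M) :
    ∫⁻ x, ENNReal.ofReal (dualMetric I h x (α x - β x) (α x - β x)) ∂μ =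
      eLpNorm (frameCoord E α - frameCoord E β) 2 μ ^ 2 := by
  rw [← frameCoord_sub, eLpNorm_frameCoord_sq hh hE]

/-- The weak form of the codifferential, tested on the closure of the exterior derivative. -/
theorem forall_inner_eq_iff (hh : IsSmoothMetric I h) (hE : IsParseval h E)
    (hEm : ∀ i, IsMeasurableField μ (E i)) (f : Lp ℝ 2 μ)
    (k : Lp (EuclideanSpace ℝ (Fin n)) 2 μ) :
    (∀ q ∈ (extDerGraph E μ).topologicalClosure, ⟪q.fst, f⟫_ℝ = ⟪q.snd, k⟫_ℝ) ↔
      ∀ v : M → ℝ, ContMDiff I 𝓘(ℝ, ℝ) ∞ v →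
        ∫ x, v x * f x ∂μ = ∫ x, ⟪frameCoord E (extDer I v) x, k x⟫_ℝ ∂μ := by
  have key : ∀ {v : M → ℝ} {q : WithLp 2 (Lp ℝ 2 μ × Lp (EuclideanSpace ℝ (Fin n)) 2 μ)},
      q.fst =ᵐ[μ] v → q.snd =ᵐ[μ] frameCoord E (extDer I v) →
      (⟪q.fst, f⟫_ℝ = ⟪q.snd, k⟫_ℝ ↔
        ∫ x, v x * f x ∂μ = ∫ x, ⟪frameCoord E (extDer I v) x, k x⟫_ℝ ∂μ) := by
    intro v q h1 h2
    have h3 : ⟪q.fst, f⟫_ℝ = ∫ x, v x * f x ∂μ := by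
      rw [L2.inner_def]
      refine integral_congr_ae ?_
      filter_upwards [h1] with x hx
      rw [hx]
      exact mul_comm _ _
    have h4 : ⟪q.snd, k⟫_ℝ = ∫ x, ⟪frameCoord E (extDer I v) x, k x⟫_ℝ ∂μ := by
      rw [L2.inner_def]
      refine integral_congr_ae ?_
      filter_upwards [h2] with x hx
      rw [hx]
    rw [h3, h4]
  constructor
  · intro hq v hv
    exact (key (q := WithLp.toLp 2 (_, _)) (memLp_two_of_contMDiff hv).coeFn_toLp
      (memLp_frameCoord_extDer hh hE hEm hv).coeFn_toLp).1 (hq _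
      (Submodule.le_topologicalClosure _ (toLp_mem_extDerGraph hh hE hEm hv)))
  · intro hv q hq
    have h1 := inner_add_inner_eq_zero_of_mem_closure (a := f) (b := -k) ?_ hq
    · rw [inner_neg_left, add_neg_eq_zero] at h1
      rw [real_inner_comm, h1, real_inner_comm]
    · rintro p ⟨v, hv', h1, h2⟩
      rw [inner_neg_left, add_neg_eq_zero, real_inner_comm, (key h1 h2).2 (hv v hv'),
        real_inner_comm]

/-- From left to right α is replaced by its components, which preserves distances. From right to
left the one-form is the `frameForm` of the second component: the contraction estimate gives
convergence of the differentials, and inner products with components of one-forms are unchanged. -/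
theorem isNegLaplaceBeltrami_iff (hh : IsSmoothMetric I h) (hE : IsParseval h E)
    (hEm : ∀ i, IsMeasurableField μ (E i)) (u f : Lp ℝ 2 μ) :
    IsNegLaplaceBeltrami I h μ u f ↔ ∃ p ∈ (extDerGraph E μ).topologicalClosure, p.fst = u ∧
      ∀ q ∈ (extDerGraph E μ).topologicalClosure, ⟪q.fst, f⟫_ℝ = ⟪q.snd, p.snd⟫_ℝ := by
  constructor
  · rintro ⟨α, ⟨-, hα, w, hw, hw1, hw2⟩, -, -, hv⟩
    have hα2 := memLp_frameCoord hh hE hEm hα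
    refine ⟨WithLp.toLp 2 (u, hα2.toLp), ?_, rfl, ?_⟩
    · rw [← SetLike.mem_coe, Submodule.topologicalClosure_coe]
      refine mem_closure_of_tendsto (f := fun j => WithLp.toLp 2
        ((memLp_two_of_contMDiff (hw j)).toLp, (memLp_frameCoord_extDer hh hE hEm (hw j)).toLp))
        (b := atTop) ?_
        (Eventually.of_forall fun j => toLp_mem_extDerGraph hh hE hEm (hw j))
      refine ((WithLp.prod_continuous_toLp 2 _ _).tendsto _).comp (Tendsto.prodMk_nhds ?_ ?_)
      · have h1 := (Lp.tendsto_Lp_iff_tendsto_eLpNorm'' w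
          (fun j => memLp_two_of_contMDiff (hw j)) u (Lp.memLp u)).2 hw1
        rwa [Lp.toLp_coeFn] at h1
      · refine (Lp.tendsto_Lp_iff_tendsto_eLpNorm'' _ _ _ _).2 ?_
        simp only [lintegral_dualMetric_sub hh hE] at hw2
        have h2 := hw2.ennrpow_const ((2 : ℕ) : ℝ)⁻¹
        rw [ENNReal.zero_rpow_of_pos (by positivity)] at h2
        exact h2.congr fun j => ENNReal.pow_rpow_inv_natCast two_ne_zero _
    · refine (forall_inner_eq_iff hh hE hEm f _).2 fun v hv' => (hv v hv').trans ?_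
      refine integral_congr_ae ?_
      filter_upwards [hα2.coeFn_toLp] with x hx
      rw [← inner_frameCoord hh hE, ← hx]
      rfl
  · rintro ⟨p, hp, rfl, hq⟩
    have hα := memL2OneForm_frameForm hh hE hEm (Lp.memLp p.snd)
    refine ⟨frameForm h E p.snd, ⟨Lp.memLp _, hα, ?_⟩, hα, Lp.memLp _, fun v hv => ?_⟩
    · rw [← SetLike.mem_coe, Submodule.topologicalClosure_coe, mem_closure_iff_seq_limit] at hp
      obtain ⟨P, hP, hPp⟩ := hp
      choose w hw hw1 hw2 using hP
      have hlim := (WithLp.prod_continuous_ofLp 2 (Lp ℝ 2 μ)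
        (Lp (EuclideanSpace ℝ (Fin n)) 2 μ)).tendsto p
      refine ⟨w, hw, ?_, ?_⟩
      · have h1 := (Lp.tendsto_Lp_iff_tendsto_eLpNorm' _ _).1 ((continuous_fst.tendsto _).comp
          (hlim.comp hPp))
        refine h1.congr fun j => eLpNorm_congr_ae ?_
        exact (hw1 j).sub (ae_eq_refl _)
      · have h1 := (Lp.tendsto_Lp_iff_tendsto_eLpNorm' _ _).1 ((continuous_snd.tendsto _).comp
          (hlim.comp hPp))
        have h2 := ENNReal.Tendsto.pow (n := 2) h1
        rw [zero_pow two_ne_zero] at h2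
        refine tendsto_of_tendsto_of_tendsto_of_le_of_le tendsto_const_nhds h2
          (fun _ => zero_le) fun j => ?_
        simp only
        rw [← eLpNorm_frameCoord_sq hh hE (fun x => extDer I (w j) x - frameForm h E p.snd x)]
        refine pow_le_pow_left₀ zero_le (eLpNorm_mono_ae ?_) 2
        filter_upwards [hw2 j] with x hx
        refine (norm_frameCoord_sub_frameForm_le hh hE _ _ x).trans (le_of_eq ?_)
        rw [← hx]
        rfl
    · rw [(forall_inner_eq_iff hh hE hEm f _).1 hq v hv]
      simp_rw [inner_frameCoord_left hh hE]

end

/-- The generalized Laplace-Beltrami operator of a compact manifold with a smooth positive density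
is a densely defined self-adjoint operator. -/
theorem exists_isSelfAdjoint_isNegLaplaceBeltrami [CompactSpace M] [T2Space M]
    (hh : IsSmoothMetric I h) {r : M → ℝ} (hr : Continuous r) (hr0 : ∀ x, 0 < r x)
    (hμ : μ = densityMeasure h r) :
    ∃ A : Lp ℝ 2 μ →ₗ.[ℝ] Lp ℝ 2 μ,
      (∀ u f : Lp ℝ 2 μ, (u, f) ∈ A.graph ↔ IsNegLaplaceBeltrami I h μ u f) ∧
      Dense (A.domain : Set (Lp ℝ 2 μ)) ∧ IsSelfAdjoint A := by
  subst hμ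
  have := isFiniteMeasure_densityMeasure hh hr
  obtain ⟨n, E, hEm, hE⟩ := hh.exists_frame (densityMeasure h r)
  obtain ⟨A, hA, hdense, hself⟩ := exists_isSelfAdjoint_of_isClosed_graph
    (extDerGraph E (densityMeasure h r)).topologicalClosure
    (Submodule.isClosed_topologicalClosure _)
    (fun p hp hp0 => eq_zero_of_mem_closure_extDerGraph hh hr hr0 hE hEm (k := p.snd) (by
      rw [← hp0]
      exact hp))
    (dense_fst_extDerGraph hh hE hEm)
  exact ⟨A, fun u f => (hA u f).trans (isNegLaplaceBeltrami_iff hh hE hEm u f).symm, hdense, hself⟩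

end LagrangianHeat

theorem mainTheorem1 {d : ℕ}
    -- the ambient Riemannian manifold `(N, g)`
    {H' : Type*} [TopologicalSpace H']
    (J : ModelWithCorners ℝ (EuclideanSpace ℝ (Fin d)) H')
    {N : Type*} [TopologicalSpace N] [ChartedSpace H' N] [IsManifold J ∞ N] [T2Space N]
    (g : Bundle.ContMDiffRiemannianMetric J ∞ (EuclideanSpace ℝ (Fin d))
      (fun y : N => TangentSpace J y))
    -- the compact material manifold `M`, embedded into `N` by `ι`
    {H : Type*} [TopologicalSpace H]
    (I : ModelWithCorners ℝ (EuclideanSpace ℝ (Fin d)) H)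
    {M : Type*} [TopologicalSpace M] [ChartedSpace H M] [IsManifold I ∞ M] [CompactSpace M]
    [MeasurableSpace M] [BorelSpace M]
    (ι : M → N) (hι : LagrangianHeat.IsEmbedded I J ι)
    -- the vector field, its flow map and the fluid density
    (T : ℝ) (hT : 0 < T)
    (V : ℝ → ∀ y : N, TangentSpace J y) (hV : LagrangianHeat.IsSmoothTimeDepField J T V)
    (Φ : ℝ → M → N) (hΦ : LagrangianHeat.IsFlowMap I J T V ι Φ)
    (ρ : ℝ → N → ℝ) (hρ : LagrangianHeat.IsMassDensity J T g.inner V ρ)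
    -- the initial mass `μ₀ = ρ₀ ω_g` on `M`
    (μ₀ : Measure M) (hμ₀ : μ₀ = LagrangianHeat.massMeasure I J g.inner ι (ρ 0))
    (t : ℝ) (ht : t ∈ Icc 0 T) :
    LagrangianHeat.massMeasure I J g.inner (Φ t) (ρ t) = μ₀ ∧
    ∃ A : Lp ℝ 2 μ₀ →ₗ.[ℝ] Lp ℝ 2 μ₀,
      (∀ u f : Lp ℝ 2 μ₀, (u, f) ∈ A.graph ↔
        LagrangianHeat.IsNegLaplaceBeltrami I
          (LagrangianHeat.pullbackMetric I J (Φ t) g.inner)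
          (LagrangianHeat.massMeasure I J g.inner (Φ t) (ρ t)) u f) ∧
      Dense (A.domain : Set (Lp ℝ 2 μ₀)) ∧ IsSelfAdjoint A := by
  have : T2Space M := .of_injective_continuous hι.injective hι.smooth.continuous
  have h1 := LagrangianHeat.massMeasure_eq g hT hV hΦ hρ ht
  refine ⟨h1.trans hμ₀.symm, ?_⟩
  rw [h1.trans hμ₀.symm]
  -- By definition `massMeasure` is the `densityMeasure` of the pulled back metric with weight ρ(t,
  -- Φ^t x), so conservation of mass presents `μ₀` in this form.
  exact LagrangianHeat.exists_isSelfAdjoint_isNegLaplaceBeltrami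
    ((hΦ.embedded t ht).isSmoothMetric_pullbackMetric g)
    (LagrangianHeat.continuous_density hρ hΦ ht)
    (LagrangianHeat.density_pos g hT hV hΦ hρ ht) (hμ₀.trans h1.symm)
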